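/- Let $(\lambda_n)_{n\ge1}$ be a sequence of real numbers with $\lambda_1>0$ and $\lambda_n\ge0$ for all $n$, put $\Lambda_n:=\lambda_1+\dots+\lambda_n$, and assume that $\Lambda_n\to\infty$ and that the sequence $(\lambda_n/\Lambda_n)$ is nonincreasing with limit $\eta\in[0,1)$. Let $I\subseteq\mathbb R$ be a nondegenerate interval with $\inf I=0$. A function $E:I\times I\to\mathbb R$ is called a *quasideviation* if (a) $\operatorname{sign}E(x,y)=\operatorname{sign}(x-y)$ for all $x,y\in I$; (b) $y\mapsto E(x,y)$ is continuous on $I$ for every $x\in I$; (c) for all $x<y$ in $I$, the map $t\mapsto E(y,t)/E(x,t)$ is strictly increasing on the open interval $(x,y)$. Then for all $n\ge1$, $x_1,\dots,x_n\in I$ and weights $w_1,\dots,w_n\ge0$ with $w_1+\dots+w_n>0$, the equation $w_1E(x_1,y)+\dots+w_nE(x_n,y)=0$ has exactly one solution $y\in I$, which is denoted by $\mathscr D_E\big((x_1,\dots,x_n),(w_1,\dots,w_n)\big)$. The quasideviation $E$ is *normalizable* if, for every $x\in I$, the function $y\mapsto E(x,y)$ is differentiable at $x$ (one-sidedly if $x$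 is an endpoint of $I$), and $x\mapsto\partial_2E(x,x)$ is strictly negative and continuous on $I$; in this case put $E^*(x,y):=E(x,y)/(-\partial_2E(y,y))$. The *$\lambda$-Hardy constant* of $\mathscr D_E$ is the smallest $C\in[0,\infty]$ such that $$\sum_{n=1}^\infty\lambda_n\,\mathscr D_E\big((x_1,\dots,x_n),(\lambda_1,\dots,\lambda_n)\big)\le C\sum_{n=1}^\infty\lambda_nx_n\qquad\text{for all sequences }(x_n)\text{ in }I,$$ and $\mathscr D_E$ is called *$\lambda$-Hardy* if this constant is finite. Let $E:I\times I\to\mathbb R$ be a normalizable quasideviation such that $E^*$ is concave on $I\times I$ and $\lim_{t\to0^+}E^*(xt,t)=0$ for all $x>0$. Then the limit $$h_E(x):=\lim_{t\to0^+}\tfrac1t\,E^*(xt,t)$$ exists in $\mathbb R$ for all $x>0$, and $\mathscr D_E$ is $\lambda$-Hardy if and only if the function $x\mapsto h_E(1/x)$ is integrable over $(0,1]$. In this case, the $\lambda$-Hardy constant of $\mathscr D_E$ is the unique solution $c\in(0,\infty)$ of the equation $$\int_0^1h_E\Big(\frac1{cx}\Big)\,dx=0\quad\text{if }\eta=0,\qquad\qquad\sum_{k=0}^\infty(1-\eta)^k\,h_E\Big(\frac1{c(1-\eta)^k}\Big)=0\quad\text{if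 }\eta>0,$$ where the integral, respectively the series, converges for this $c$. -/

import Mathlib

open Set Filter Topology MeasureTheory
open scoped ENNReal

/-- `E` (of which only the values on `I × I` matter) is a quasideviation on the interval `I`. -/
structure IsQuasideviation (I : Set ℝ) (E : ℝ → ℝ → ℝ) : Prop where
  sign_eq : ∀ x ∈ I, ∀ y ∈ I, SignType.sign (E x y) = SignType.sign (x - y)
  continuousOn : ∀ x ∈ I, ContinuousOn (fun y => E x y) I
  strictMonoOn : ∀ x ∈ I, ∀ y ∈ I, x < y → StrictMonoOn (fun t => E y t / E x t) (Ioo x y)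

/-- The value `∂₂E(y, y)` of the partial derivative of `E` on the diagonal of `I × I`
(one-sided at an endpoint of `I` that belongs to `I`). -/
noncomputable def diagDeriv (I : Set ℝ) (E : ℝ → ℝ → ℝ) (y : ℝ) : ℝ :=
  derivWithin (fun t => E y t) I y

/-- A normalizable quasideviation on `I`. -/
structure IsNormalizableQuasideviation (I : Set ℝ) (E : ℝ → ℝ → ℝ) : Prop
    extends IsQuasideviation I E where
  differentiable : ∀ x ∈ I, DifferentiableWithinAt ℝ (fun y => E x y) I x
  diagDeriv_neg : ∀ x ∈ I, diagDeriv I E x < 0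
  continuousOn_diagDeriv : ContinuousOn (diagDeriv I E) I

/-- The normalization `E^*` of `E`, `E^*(x, y) = E(x, y) / (-∂₂E(y, y))`. -/
noncomputable def normalization (I : Set ℝ) (E : ℝ → ℝ → ℝ) (x y : ℝ) : ℝ :=
  E x y / (-diagDeriv I E y)

open Classical in
/-- The weighted `E`-quasideviation mean `D_E(x, w)`: the solution `y ∈ I` of
`w₁ E(x₁, y) + ⋯ + wₙ E(xₙ, y) = 0`. It exists and is unique whenever the entries of `x` lie in `I`
and the weights are nonnegative with positive sum, see `existsUnique_quasideviationMean`. -/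
noncomputable def quasideviationMean (I : Set ℝ) (E : ℝ → ℝ → ℝ) (n : ℕ) (x w : Fin n → ℝ) : ℝ :=
  if h : ∃ y ∈ I, ∑ i, w i * E (x i) y = 0 then h.choose else 0

/-- The `w`-weighted Hardy constant of a weighted mean `M` on an interval `I ⊆ [0, ∞)`: the smallest
`C ∈ [0, ∞]` such that `∑ wₙ M((x₁, …, xₙ), (w₁, …, wₙ)) ≤ C ∑ wₙ xₙ` for all sequences `x` in `I`.
Sequences are indexed from `0`. -/
noncomputable def hardyConstant (I : Set ℝ) (M : (n : ℕ) → (Fin n → ℝ) → (Fin n → ℝ) → ℝ)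
    (w : ℕ → ℝ) : ℝ≥0∞ :=
  sInf {C : ℝ≥0∞ | ∀ x : ℕ → ℝ, (∀ n, x n ∈ I) →
    ∑' n, ENNReal.ofReal (w n * M (n + 1) (fun i => x i) (fun i => w i)) ≤
      C * ∑' n, ENNReal.ofReal (w n * x n)}

/-- `M` is a `w`-weighted Hardy mean on `I`. -/
def IsHardyMean (I : Set ℝ) (M : (n : ℕ) → (Fin n → ℝ) → (Fin n → ℝ) → ℝ) (w : ℕ → ℝ) : Prop :=
  hardyConstant I M w < ∞

/-- `h_E(x) = lim_{t → 0+} E^*(x t, t) / t`. -/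
noncomputable def homogenizedDeviation (I : Set ℝ) (E : ℝ → ℝ → ℝ) (x : ℝ) : ℝ :=
  limUnder (𝓝[>] (0 : ℝ)) (fun t => t⁻¹ * normalization I E (x * t) t)

/-- The positive number `c` solves `∫₀¹ f(1/(cx)) dx = 0` if `η = 0`, and
`∑ₖ (1-η)ᵏ f(1/(c(1-η)ᵏ)) = 0` if `η > 0`; the integral and the series have to converge. -/
def SolvesHardyEquation (f : ℝ → ℝ) (η c : ℝ) : Prop :=
  0 < c ∧
  (η = 0 → IntegrableOn (fun x => f (1 / (c * x))) (Ioc 0 1) ∧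
    ∫ x in Ioc (0 : ℝ) 1, f (1 / (c * x)) = 0) ∧
  (0 < η → HasSum (fun k : ℕ => (1 - η) ^ k * f (1 / (c * (1 - η) ^ k))) 0)

/-- Two distinct points of `I` cannot both solve the equation that defines the mean. -/
theorem IsQuasideviation.not_two_zeros {I : Set ℝ} {E : ℝ → ℝ → ℝ} (hE : IsQuasideviation I E)
    {n : ℕ} (x w : Fin n → ℝ) (hx : ∀ i, x i ∈ I) (hw : ∀ i, 0 ≤ w i) (hpos : 0 < ∑ i, w i)
    {a b : ℝ} (ha : a ∈ I) (hb : b ∈ I) (hab : a < b)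
    (h0 : ∑ i, w i * E (x i) a = 0) (h1 : ∑ i, w i * E (x i) b = 0) : False := by
  have neg : ∀ x ∈ I, ∀ y ∈ I, x < y → E x y < 0 := fun x hx y hy h => by
    have := hE.sign_eq x hx y hy
    rw [sign_neg (by linarith : x - y < 0)] at this
    exact sign_eq_neg_one_iff.1 this
  have pos : ∀ x ∈ I, ∀ y ∈ I, y < x → 0 < E x y := fun x hx y hy h => by
    have := hE.sign_eq x hx y hy
    rw [sign_pos (by linarith : 0 < x - y)] at this
    exact sign_eq_one_iff.1 this
  have zero : ∀ x ∈ I, E x x = 0 := fun x hx => by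
    have := hE.sign_eq x hx x hx
    simpa using this
  have key : ∀ p ∈ I, ∀ q ∈ I, p ≤ a → b ≤ q → E p a * E q b - E q a * E p b > 0 := by
    intro p hp q hq hpa hbq
    have e1 : 0 < E q a := pos q hq a ha (by linarith)
    have e2 : E p b < 0 := neg p hp b hb (by linarith)
    rcases hpa.eq_or_lt with rfl | hpa
    · rw [zero p hp]; nlinarith
    rcases hbq.eq_or_lt with rfl | hbq
    · rw [zero b hb]; nlinarith
    have e3 : E p a < 0 := neg p hp a ha hpa
    have := hE.strictMonoOn p hp q hq (by linarith) ⟨hpa, by linarith⟩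
      ⟨by linarith, hbq⟩ hab
    simp only at this
    rw [← neg_div_neg_eq (E q a), ← neg_div_neg_eq (E q b),
      div_lt_div_iff₀ (by linarith) (by linarith)] at this
    nlinarith
  have key' : ∀ p ∈ I, ∀ q ∈ I, E p a ≤ 0 → 0 ≤ E q b → 0 < E p a * E q b - E q a * E p b := by
    intro p hp q hq h h'
    refine key p hp q hq ?_ ?_
    · by_contra! hc
      exact absurd (pos p hp a ha hc) (by linarith)
    · by_contra! hc
      exact absurd (neg q hq b hb hc) (by linarith)
  classical
  set N := Finset.univ.filter (fun i => x i ≤ a) with hN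
  set P := Finset.univ.filter (fun i => b ≤ x i) with hP
  have cN : ∀ i ∉ N, 0 < E (x i) a := fun i hi => pos _ (hx i) _ ha (by simpa [hN] using hi)
  have cP : ∀ i ∉ P, E (x i) b < 0 := fun i hi => neg _ (hx i) _ hb (by simpa [hP] using hi)
  have dis : ∀ i ∈ N, E (x i) b < 0 := fun i hi =>
    neg _ (hx i) _ hb (by simp [hN] at hi; linarith)
  have dis' : ∀ i ∈ P, 0 < E (x i) a := fun i hi =>
    pos _ (hx i) _ ha (by simp [hP] at hi; linarith)
  -- some index with positive weight lies in `N`, and some in `P`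
  have exN : ∃ i ∈ N, 0 < w i := by
    by_contra! hc
    have hnn : ∀ i ∈ Finset.univ, 0 ≤ w i * E (x i) a := by
      intro i _
      by_cases hi : i ∈ N
      · have : w i = 0 := le_antisymm (hc i hi) (hw i)
        simp [this]
      · exact mul_nonneg (hw i) (cN i hi).le
    have hz := (Finset.sum_eq_zero_iff_of_nonneg hnn).1 h0
    have : ∑ i, w i = 0 := Finset.sum_eq_zero fun i _ => by
      by_cases hi : i ∈ N
      · exact le_antisymm (hc i hi) (hw i)
      · exact (mul_eq_zero.1 (hz i (Finset.mem_univ i))).resolve_right (cN i hi).ne'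
    linarith
  have exP : ∃ i ∈ P, 0 < w i := by
    by_contra! hc
    have hnn : ∀ i ∈ Finset.univ, w i * E (x i) b ≤ 0 := by
      intro i _
      by_cases hi : i ∈ P
      · have : w i = 0 := le_antisymm (hc i hi) (hw i)
        simp [this]
      · exact mul_nonpos_of_nonneg_of_nonpos (hw i) (cP i hi).le
    have hz := (Finset.sum_eq_zero_iff_of_nonpos hnn).1 h1
    have : ∑ i, w i = 0 := Finset.sum_eq_zero fun i _ => by
      by_cases hi : i ∈ P
      · exact le_antisymm (hc i hi) (hw i)
      · exact (mul_eq_zero.1 (hz i (Finset.mem_univ i))).resolve_right (cP i hi).ne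
    linarith
  obtain ⟨i₀, hi₀, wi₀⟩ := exN
  obtain ⟨j₀, hj₀, wj₀⟩ := exP
  have mN : ∀ i ∈ N, x i ≤ a := fun i hi => by simpa [hN] using hi
  have mP : ∀ i ∈ P, b ≤ x i := fun i hi => by simpa [hP] using hi
  have strict : 0 < ∑ i ∈ N, ∑ j ∈ P,
      w i * w j * (E (x i) a * E (x j) b - E (x j) a * E (x i) b) := by
    have nn : ∀ i ∈ N, ∀ j ∈ P,
        0 ≤ w i * w j * (E (x i) a * E (x j) b - E (x j) a * E (x i) b) := fun i hi j hj =>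
      mul_nonneg (mul_nonneg (hw i) (hw j)) (key _ (hx i) _ (hx j) (mN i hi) (mP j hj)).le
    refine Finset.sum_pos' (fun i hi => Finset.sum_nonneg (nn i hi)) ⟨i₀, hi₀, ?_⟩
    refine Finset.sum_pos' (nn i₀ hi₀) ⟨j₀, hj₀, ?_⟩
    exact mul_pos (mul_pos wi₀ wj₀) (key _ (hx i₀) _ (hx j₀) (mN _ hi₀) (mP _ hj₀))
  have expand : ∑ i ∈ N, ∑ j ∈ P,
      w i * w j * (E (x i) a * E (x j) b - E (x j) a * E (x i) b) =
      (∑ i ∈ N, w i * E (x i) a) * (∑ j ∈ P, w j * E (x j) b) -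
        (∑ j ∈ P, w j * E (x j) a) * (∑ i ∈ N, w i * E (x i) b) := by
    rw [Finset.sum_mul_sum, mul_comm (∑ j ∈ P, w j * E (x j) a), Finset.sum_mul_sum,
      ← Finset.sum_sub_distrib]
    refine Finset.sum_congr rfl fun i _ => ?_
    rw [← Finset.sum_sub_distrib]
    exact Finset.sum_congr rfl fun j _ => by ring
  have sN : ∑ i ∈ N, w i * E (x i) a + ∑ i ∈ Nᶜ, w i * E (x i) a = 0 := by
    rw [Finset.sum_add_sum_compl]; exact h0
  have sP : ∑ i ∈ P, w i * E (x i) b + ∑ i ∈ Pᶜ, w i * E (x i) b = 0 := by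
    rw [Finset.sum_add_sum_compl]; exact h1
  have subP : P ⊆ Nᶜ := fun i hi => by
    have := mP i hi
    simp only [Finset.mem_compl]
    exact fun h => by linarith [mN i h]
  have subN : N ⊆ Pᶜ := fun i hi => by
    have := mN i hi
    simp only [Finset.mem_compl]
    exact fun h => by linarith [mP i h]
  have l1 : ∑ i ∈ P, w i * E (x i) a ≤ ∑ i ∈ Nᶜ, w i * E (x i) a :=
    Finset.sum_le_sum_of_subset_of_nonneg subP fun i hi _ =>
      mul_nonneg (hw i) (cN i (Finset.mem_compl.1 hi)).le
  have l2 : ∑ i ∈ Pᶜ, w i * E (x i) b ≤ ∑ i ∈ N, w i * E (x i) b := by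
    have := Finset.sum_le_sum_of_subset_of_nonneg (f := fun i => -(w i * E (x i) b)) subN
      fun i hi _ => by
        have := mul_nonpos_of_nonneg_of_nonpos (hw i) (cP i (Finset.mem_compl.1 hi)).le
        linarith
    simp only [Finset.sum_neg_distrib] at this
    linarith
  have p1 : 0 ≤ ∑ i ∈ P, w i * E (x i) a :=
    Finset.sum_nonneg fun i hi => mul_nonneg (hw i) (dis' i hi).le
  have p2 : ∑ i ∈ N, w i * E (x i) b ≤ 0 :=
    Finset.sum_nonpos fun i hi => mul_nonpos_of_nonneg_of_nonpos (hw i) (dis i hi).le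
  rw [expand] at strict
  set A := ∑ i ∈ N, w i * E (x i) a
  set B := ∑ i ∈ P, w i * E (x i) b
  set C := ∑ i ∈ P, w i * E (x i) a
  set D := ∑ i ∈ N, w i * E (x i) b
  have q1 : C ≤ -A := by linarith
  have q2 : -D ≤ B := by linarith
  nlinarith [mul_le_mul q1 q2 (by linarith) (by linarith)]

/-- The equation that defines the quasideviation mean has exactly one solution. -/
theorem existsUnique_quasideviationMean {I : Set ℝ} [I.OrdConnected] {E : ℝ → ℝ → ℝ}
    (hE : IsQuasideviation I E) {n : ℕ} (x w : Fin n → ℝ) (hx : ∀ i, x i ∈ I)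
    (hw : ∀ i, 0 ≤ w i) (hpos : 0 < ∑ i, w i) :
    ∃! y, y ∈ I ∧ ∑ i, w i * E (x i) y = 0 := by
  have hne : Nonempty (Fin n) := by
    by_contra h
    rw [not_nonempty_iff] at h
    simp at hpos
  obtain ⟨i₀, h₀⟩ := Finite.exists_min x
  obtain ⟨i₁, h₁⟩ := Finite.exists_max x
  have hsub : Icc (x i₀) (x i₁) ⊆ I := OrdConnected.out ‹_› (hx i₀) (hx i₁)
  have hcont : ContinuousOn (fun y => ∑ i, w i * E (x i) y) (Icc (x i₀) (x i₁)) :=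
    continuousOn_finsetSum _ fun i _ =>
      continuousOn_const.mul ((hE.continuousOn _ (hx i)).mono hsub)
  have hl : 0 ≤ ∑ i, w i * E (x i) (x i₀) := Finset.sum_nonneg fun i _ => by
    refine mul_nonneg (hw i) ?_
    have := hE.sign_eq _ (hx i) _ (hx i₀)
    rw [← sign_nonneg_iff, this, sign_nonneg_iff]
    linarith [h₀ i]
  have hr : ∑ i, w i * E (x i) (x i₁) ≤ 0 := Finset.sum_nonpos fun i _ => by
    refine mul_nonpos_of_nonneg_of_nonpos (hw i) ?_
    have := hE.sign_eq _ (hx i) _ (hx i₁)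
    rw [← sign_nonpos_iff, this, sign_nonpos_iff]
    linarith [h₁ i]
  obtain ⟨y, hy, hy0⟩ := intermediate_value_Icc' (h₀ i₁) hcont ⟨hr, hl⟩
  refine ⟨y, ⟨hsub hy, hy0⟩, ?_⟩
  rintro z ⟨hz, hz0⟩
  rcases lt_trichotomy z y with h | h | h
  · exact (hE.not_two_zeros x w hx hw hpos hz (hsub hy) h hz0 hy0).elim
  · exact h
  · exact (hE.not_two_zeros x w hx hw hpos (hsub hy) hz h hy0 hz0).elim

/-!
# The weighted Hardy constant of a concave quasideviation mean

Write `Λₙ = w₀ + ⋯ + wₙ`, let `e` be the normalization of `E` and `h` its homogenization.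
Concavity of `e` along the rays through the origin makes `e(x t, t) / t` increase to `h(x)` as `t`
decreases to `0`. Hence `h` exists, is concave on `(0, ∞)`, has the sign of `x - 1`, and dominates
`e` in the sense that `e(x, y) ≤ y h(x / y)`. The argument uses the perspective `G(z) = z h(1 /
z)`, which is again concave, the geometric sums `V(z) = ∑ₖ G(z ρᵏ)`, and, if `η = 0`, the integral
`W(z) = ∫₀ᶻ h(1 / y) dy`, whose Riemann sums over geometric partitions are multiples of `V`. The
equation for `c` says `V(c) = 0` with `ρ = 1 - η`, or `W(c) = 0`. Both functions are concave,
positive on `(0, 1]` and negative somewhere, so they change sign exactly once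
(`ConcaveOn.exists_sign_change`).

*Upper bound.* Let `yₙ` be the mean of `x₀, …, xₙ`. A weighted Kedlaya inequality
(`IsConcaveDeviation.sum_cumMean_nonneg`), which needs only that `wₙ / Λₙ` does not increase, says
that the arithmetic mean `Y` of `y₀, …, yₙ` satisfies `∑ⱼ wⱼ e(Aⱼ, Y) ≥ 0`, where `Aⱼ` is the
arithmetic mean of `x₀, …, xⱼ`. With `S = ∑ wⱼ xⱼ` one has `Aⱼ ≤ S / Λⱼ`, so `∑ⱼ wⱼ h(S / (Λⱼ Y))
≥ 0`. By concavity of `G`, this sum is, up to a positive factor, at most `V(Λₙ Y / S)` for every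
`ρ` with `1 - ρ ≤ wⱼ / Λⱼ` (`IsHardyWeight.sum_perspective_le_geomSum`), so `Λₙ Y / S` does not
exceed the zero of `V` or `W`.

*Lower bound.* For the test sequence `xₙ = ε / Λₙ`, the mean `yₙ` is eventually at least `c ε /
Λₙ` whenever a truncation of `V(c)` is positive (`IsConcaveDeviation.eventually_test_nonneg`).
Since `∑ wₙ / Λₙ` diverges, the Hardy constant is then at least `c` (`le_hardyConstant`). The
points `Λⱼ / Λₙ` are asymptotically equidistributed if `η = 0`, when every `ρ` is admissible, and
cluster at the powers of `1 - η` if `η > 0`. If `h(1 / x)` is not integrable on `(0, 1]`, then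
truncations of `V(c)` are positive for every `c`, so the mean is not Hardy.
-/

/-! ### Concave kernels on the half-line -/

/-- A concave kernel: a concave function on `(0, ∞)` with the sign of `x - 1`. -/
structure IsConcaveKernel (h : ℝ → ℝ) : Prop where
  concaveOn : ConcaveOn ℝ (Ioi 0) h
  one : h 1 = 0
  pos : ∀ x, 1 < x → 0 < h x
  neg : ∀ x, 0 < x → x < 1 → h x < 0

/-- The perspective `z ↦ z h(1/z)` of `h`. -/
noncomputable def perspective (h : ℝ → ℝ) (z : ℝ) : ℝ := z * h (1 / z)

namespace IsConcaveKernel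

variable {h : ℝ → ℝ}

/-- A concave function on `(0, ∞)` that is positive near infinity cannot decrease anywhere. -/
theorem monotoneOn (hh : IsConcaveKernel h) : MonotoneOn h (Ioi 0) := by
  intro x hx y hy hxy
  rcases hxy.eq_or_lt with rfl | hxy
  · exact le_rfl
  by_contra! hlt
  have hx' : 0 < x := hx
  have hd : 0 < (h x - h y) / (y - x) := div_pos (by linarith) (by linarith)
  set d := (h x - h y) / (y - x) with hd'
  -- `z` is so far to the right that the chord through `x` and `y` is negative there
  set z := y + (|h y| / d + 1) with hz
  have hq : 0 ≤ |h y| / d := by positivity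
  have hyz : y < z := by linarith
  have key := hh.concaveOn.slope_anti_adjacent hx (show (0 : ℝ) < z by linarith) hxy hyz
  have e1 : (h y - h x) / (y - x) = -d := by rw [hd', ← neg_div]; ring
  rw [e1, div_le_iff₀ (by linarith)] at key
  have e2 : d * (z - y) = |h y| + d := by rw [hz]; field_simp; ring
  have h1 : 0 < h z := hh.pos z (by linarith)
  nlinarith [le_abs_self (h y)]

theorem antitoneOn_inv (hh : IsConcaveKernel h) : AntitoneOn (fun y => h (1 / y)) (Ioi 0) :=
  fun x (hx : 0 < x) y (hy : 0 < y) hxy =>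
    hh.monotoneOn (show (0 : ℝ) < 1 / y by positivity) (show (0 : ℝ) < 1 / x by positivity)
      (one_div_le_one_div_of_le hx hxy)

theorem concaveOn_perspective (hh : IsConcaveKernel h) :
    ConcaveOn ℝ (Ioi 0) (perspective h) := by
  refine ⟨convex_Ioi 0, fun x hx y hy a b ha hb hab => ?_⟩
  have hx' : 0 < x := hx
  have hy' : 0 < y := hy
  have hz : 0 < a * x + b * y := convex_Ioi (0 : ℝ) hx hy ha hb hab
  have key := hh.concaveOn.2 (show (0 : ℝ) < 1 / x by positivity)
    (show (0 : ℝ) < 1 / y by positivity)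
    (show 0 ≤ a * x / (a * x + b * y) by positivity)
    (show 0 ≤ b * y / (a * x + b * y) by positivity) (by field_simp)
  have e : (a * x / (a * x + b * y)) • (1 / x) + (b * y / (a * x + b * y)) • (1 / y) =
      1 / (a * x + b * y) := by
    simp only [smul_eq_mul]
    field_simp
    exact hab
  rw [e] at key
  simp only [smul_eq_mul, perspective] at key ⊢
  have := mul_le_mul_of_nonneg_left key hz.le
  refine le_trans (le_of_eq ?_) this
  field_simp

theorem perspective_one (hh : IsConcaveKernel h) : perspective h 1 = 0 := by
  simp [perspective, hh.one]

theorem perspective_pos (hh : IsConcaveKernel h) {z : ℝ} (h0 : 0 < z) (h1 : z < 1) :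
    0 < perspective h z :=
  mul_pos h0 (hh.pos _ (by rw [lt_div_iff₀ h0]; linarith))

theorem perspective_nonneg (hh : IsConcaveKernel h) {z : ℝ} (h0 : 0 < z) (h1 : z ≤ 1) :
    0 ≤ perspective h z := by
  rcases h1.eq_or_lt with rfl | h1
  · exact hh.perspective_one.ge
  · exact (hh.perspective_pos h0 h1).le

theorem perspective_neg (hh : IsConcaveKernel h) {z : ℝ} (h1 : 1 < z) :
    perspective h z < 0 :=
  mul_neg_of_pos_of_neg (by linarith)
    (hh.neg _ (by positivity) (by rw [div_lt_one (by linarith)]; exact h1))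

/-- The values of the perspective at `ρ s`, `r s`, `s` compared by concavity. -/
theorem perspective_three_point (hh : IsConcaveKernel h) {r ρ s : ℝ} (hr : 0 < r) (hrρ : r ≤ ρ)
    (hρ : ρ < 1) (hs : 0 < s) :
    (1 - ρ) * perspective h (r * s) + (ρ - r) * perspective h s ≤
      (1 - r) * perspective h (ρ * s) := by
  have hr1 : 0 < 1 - r := by linarith
  have key := hh.concaveOn_perspective.2 (show (0 : ℝ) < r * s by positivity) hs
    (show 0 ≤ (1 - ρ) / (1 - r) from div_nonneg (by linarith) hr1.le)
    (show 0 ≤ (ρ - r) / (1 - r) from div_nonneg (by linarith) hr1.le)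
    (by field_simp; ring)
  have e : ((1 - ρ) / (1 - r)) • (r * s) + ((ρ - r) / (1 - r)) • s = ρ * s := by
    simp only [smul_eq_mul]
    field_simp
    ring
  rw [e] at key
  simp only [smul_eq_mul] at key
  have := mul_le_mul_of_nonneg_left key hr1.le
  refine le_trans (le_of_eq ?_) this
  field_simp

end IsConcaveKernel

/-! ### Geometric sums of the perspective -/

/-- The sum `∑ₖ z ρᵏ h(1/(z ρᵏ))`; up to the factor `1 - ρ` it is the sum of `y ↦ h(1/y)` over
the right endpoints of the geometric partition of `(0, z]` with ratio `ρ`. -/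
noncomputable def geomSum (h : ℝ → ℝ) (ρ z : ℝ) : ℝ := ∑' k : ℕ, perspective h (z * ρ ^ k)

/-- All the series that define `geomSum h ρ` converge. -/
def GeomSummable (h : ℝ → ℝ) (ρ : ℝ) : Prop :=
  ∀ z, 0 < z → Summable fun k : ℕ => perspective h (z * ρ ^ k)

section GeomSum

variable {h : ℝ → ℝ} {ρ : ℝ}

theorem GeomSummable.geomSum_eq_add (hs : GeomSummable h ρ) {z : ℝ} (hz : 0 < z) :
    geomSum h ρ z = perspective h z + geomSum h ρ (ρ * z) := by
  rw [geomSum, (hs z hz).tsum_eq_zero_add, geomSum]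
  simp only [pow_zero, mul_one]
  congr 2
  ext k
  rw [pow_succ]
  ring_nf

theorem IsConcaveKernel.concaveOn_geomSum (hh : IsConcaveKernel h) (hρ : 0 < ρ)
    (hs : GeomSummable h ρ) : ConcaveOn ℝ (Ioi 0) (geomSum h ρ) := by
  refine ⟨convex_Ioi 0, fun x hx y hy a b ha hb hab => ?_⟩
  have hx' : 0 < x := hx
  have hy' : 0 < y := hy
  have hz : 0 < a * x + b * y := convex_Ioi (0 : ℝ) hx hy ha hb hab
  simp only [smul_eq_mul, geomSum]
  rw [← tsum_mul_left, ← tsum_mul_left,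
    ← ((hs x hx).mul_left a).tsum_add ((hs y hy).mul_left b)]
  refine (((hs x hx).mul_left a).add ((hs y hy).mul_left b)).tsum_le_tsum (fun k => ?_) (hs _ hz)
  have := hh.concaveOn_perspective.2 (show (0 : ℝ) < x * ρ ^ k by positivity)
    (show (0 : ℝ) < y * ρ ^ k by positivity) ha hb hab
  simp only [smul_eq_mul] at this
  refine this.trans (le_of_eq ?_)
  congr 1
  ring

theorem IsConcaveKernel.geomSum_pos (hh : IsConcaveKernel h) (hρ : 0 < ρ) (hρ1 : ρ < 1)
    (hs : GeomSummable h ρ) {z : ℝ} (hz : 0 < z) (hz1 : z ≤ 1) : 0 < geomSum h ρ z := by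
  have hk : ∀ k : ℕ, z * ρ ^ k ≤ 1 := fun k =>
    mul_le_one₀ hz1 (by positivity) (pow_le_one₀ hρ.le hρ1.le)
  refine (hs z hz).tsum_pos (fun k => hh.perspective_nonneg (by positivity) (hk k)) 1 ?_
  refine hh.perspective_pos (by positivity) ?_
  rw [pow_one]
  nlinarith

theorem IsConcaveKernel.exists_geomSum_neg (hh : IsConcaveKernel h) (hρ : 0 < ρ) (hρ1 : ρ < 1)
    (hs : GeomSummable h ρ) : ∃ z, 0 < z ∧ geomSum h ρ z < 0 := by
  have hd : perspective h ρ⁻¹ < 0 := hh.perspective_neg ((one_lt_inv₀ hρ).2 hρ1)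
  set d := perspective h ρ⁻¹ with hd'
  have hanti : ∀ z, ρ⁻¹ ≤ z → perspective h z ≤ d := by
    intro z hz
    have h1 : 1 < ρ⁻¹ := (one_lt_inv₀ hρ).2 hρ1
    rcases hz.eq_or_lt with rfl | hz
    · exact le_rfl
    have := hh.concaveOn_perspective.slope_anti_adjacent (show (0 : ℝ) < 1 by norm_num)
      (show (0 : ℝ) < z by linarith) h1 hz
    rw [hh.perspective_one, ← hd', sub_zero] at this
    have h2 : d / (ρ⁻¹ - 1) < 0 := div_neg_of_neg_of_pos hd (by linarith)
    have h3 := this.trans h2.le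
    rw [div_le_iff₀ (by linarith)] at h3
    linarith
  -- each division of the argument by `ρ` lowers the sum by at least `-d`
  have step : ∀ m : ℕ, geomSum h ρ (ρ⁻¹ ^ m) ≤ geomSum h ρ 1 + m * d := by
    intro m
    induction m with
    | zero => simp
    | succ m ih =>
      rw [hs.geomSum_eq_add (by positivity)]
      have e : ρ * ρ⁻¹ ^ (m + 1) = ρ⁻¹ ^ m := by rw [pow_succ]; field_simp
      rw [e]
      have := hanti (ρ⁻¹ ^ (m + 1)) (le_self_pow₀ ((one_lt_inv₀ hρ).2 hρ1).le (by simp))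
      push_cast
      linarith
  obtain ⟨m, hm⟩ := exists_nat_gt (geomSum h ρ 1 / (-d))
  rw [div_lt_iff₀ (by linarith)] at hm
  exact ⟨ρ⁻¹ ^ m, by positivity, by linarith [step m]⟩

/-- If `geomSum h ρ` is positive then so is one of its partial sums, and the terms left out are
nonnegative. -/
theorem exists_partial_geomSum_pos (hρ : 0 < ρ) (hρ1 : ρ < 1)
    (hs : GeomSummable h ρ) {z : ℝ} (hz : 0 < z) (hpos : 0 < geomSum h ρ z) :
    ∃ K : ℕ, z * ρ ^ K ≤ 1 ∧ 0 < ∑ k ∈ Finset.range K, perspective h (z * ρ ^ k) := by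
  have h1 := ((hs z hz).hasSum.tendsto_sum_nat).eventually (lt_mem_nhds hpos)
  have h2 : Tendsto (fun k : ℕ => z * ρ ^ k) atTop (𝓝 (z * 0)) :=
    (tendsto_pow_atTop_nhds_zero_of_lt_one hρ.le hρ1).const_mul z
  rw [mul_zero] at h2
  obtain ⟨K, hK⟩ := (h1.and (h2.eventually (ge_mem_nhds zero_lt_one))).exists
  exact ⟨K, hK.2, hK.1⟩

/-- If no partial sum whose omitted terms are nonnegative is positive, then the series
converges. -/
theorem IsConcaveKernel.summable_of_partial_nonpos (hh : IsConcaveKernel h) (hρ : 0 < ρ)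
    (hρ1 : ρ < 1) {z : ℝ} (hz : 0 < z)
    (hle : ∀ K : ℕ, z * ρ ^ K ≤ 1 → ∑ k ∈ Finset.range K, perspective h (z * ρ ^ k) ≤ 0) :
    Summable fun k : ℕ => perspective h (z * ρ ^ k) := by
  have h2 : Tendsto (fun k : ℕ => z * ρ ^ k) atTop (𝓝 (z * 0)) :=
    (tendsto_pow_atTop_nhds_zero_of_lt_one hρ.le hρ1).const_mul z
  rw [mul_zero] at h2
  obtain ⟨N, hN⟩ := eventually_atTop.1 (h2.eventually (ge_mem_nhds zero_lt_one))
  rw [← summable_nat_add_iff N]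
  refine summable_of_sum_range_le (c := -∑ k ∈ Finset.range N, perspective h (z * ρ ^ k))
    (fun k => hh.perspective_nonneg (by positivity) (hN _ (by omega))) (fun n => ?_)
  have := hle (N + n) (hN _ (by omega))
  rw [Finset.sum_range_add] at this
  simp only [add_comm _ N]
  linarith

end GeomSum

/-! ### Roots of concave functions on the half-line -/

/-- A concave function on `(0, ∞)` that is positive on `(0, 1]` and negative somewhere changes its
sign exactly once. -/
theorem ConcaveOn.exists_sign_change {W : ℝ → ℝ} (hW : ConcaveOn ℝ (Ioi 0) W)
    (hpos : ∀ z, 0 < z → z ≤ 1 → 0 < W z) (hneg : ∃ z, 0 < z ∧ W z < 0) :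
    ∃ c, 1 < c ∧ W c = 0 ∧ (∀ z, c < z → W z < 0) ∧ ∀ z, 0 < z → z < c → 0 < W z := by
  obtain ⟨z, hz, hWz⟩ := hneg
  have hz1 : 1 < z := by
    by_contra! hc
    linarith [hpos z hz hc]
  have hcont : ContinuousOn W (Icc 1 z) :=
    (hW.continuousOn isOpen_Ioi).mono fun y hy => lt_of_lt_of_le one_pos hy.1
  obtain ⟨c, hc, hc0⟩ := intermediate_value_Icc' hz1.le hcont
    ⟨hWz.le, (hpos 1 one_pos le_rfl).le⟩
  have hc1 : 1 < c := by
    rcases hc.1.eq_or_lt with h | h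
    · linarith [hpos c (by linarith) h.ge]
    · exact h
  have mid : ∀ x y, 1 ≤ x → x < y → 0 < W 1 → 0 ≤ W y → 0 < W x := by
    intro x y hx hxy h1 hy
    rcases hx.eq_or_lt with rfl | hx
    · exact h1
    by_contra! hn
    have := hW.slope_anti_adjacent (show (0 : ℝ) < 1 by norm_num)
      (show (0 : ℝ) < y by linarith) hx hxy
    have e1 : (W x - W 1) / (x - 1) < 0 := div_neg_of_neg_of_pos (by linarith) (by linarith)
    have e2 : 0 ≤ (W y - W x) / (y - x) := div_nonneg (by linarith) (by linarith)
    linarith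
  have h1 := hpos 1 one_pos le_rfl
  refine ⟨c, hc1, hc0, fun y hy => ?_, fun y hy hyc => ?_⟩
  · by_contra! hn
    exact (mid c y hc1.le hy h1 hn).ne' hc0
  · rcases le_total y 1 with h | h
    · exact hpos y hy h
    · exact mid y c h hyc h1 hc0.ge

/-! ### Integrals of antitone functions near the origin -/

section AntitoneIntegral

variable {f : ℝ → ℝ}

theorem AntitoneOn.integrableOn_Ioc_of_pos (hf : AntitoneOn f (Ioi 0)) {a b : ℝ} (ha : 0 < a) :
    IntegrableOn f (Ioc a b) :=
  ((hf.mono fun _ hx => ha.trans_le hx.1).integrableOn_isCompact isCompact_Icc).mono_set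
    Ioc_subset_Icc_self

theorem AntitoneOn.mul_le_setIntegral_Ioc (hf : AntitoneOn f (Ioi 0)) {a b : ℝ} (ha : 0 < a)
    (hab : a ≤ b) : (b - a) * f b ≤ ∫ x in Ioc a b, f x := by
  have h := setIntegral_mono_on (μ := volume) (integrableOn_const (C := f b) (by simp))
    (hf.integrableOn_Ioc_of_pos ha) measurableSet_Ioc
    fun x hx => hf (ha.trans hx.1) (ha.trans_le hab) hx.2
  simpa [hab] using h

theorem AntitoneOn.setIntegral_Ioc_le_mul (hf : AntitoneOn f (Ioi 0)) {a b : ℝ} (ha : 0 < a)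
    (hab : a ≤ b) : ∫ x in Ioc a b, f x ≤ (b - a) * f a := by
  have h := setIntegral_mono_on (μ := volume) (hf.integrableOn_Ioc_of_pos ha (b := b))
    (integrableOn_const (C := f a) (by simp)) measurableSet_Ioc
    fun x hx => hf ha (ha.trans hx.1) hx.1.le
  simpa [hab] using h

theorem AntitoneOn.integrableOn_Ioc_zero (hf : AntitoneOn f (Ioi 0)) {a : ℝ} (ha : 0 < a)
    (hi : IntegrableOn f (Ioc 0 a)) (b : ℝ) : IntegrableOn f (Ioc 0 b) :=
  (hi.union (hf.integrableOn_Ioc_of_pos ha (b := b))).mono_set fun x hx => by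
    rcases le_or_gt x a with h | h
    · exact Or.inl ⟨hx.1, h⟩
    · exact Or.inr ⟨h, hx.2⟩

theorem setIntegral_Ioc_zero_add {a b : ℝ} (ha : 0 ≤ a) (hab : a ≤ b)
    (hi : IntegrableOn f (Ioc 0 b)) :
    ∫ x in Ioc 0 b, f x = (∫ x in Ioc 0 a, f x) + ∫ x in Ioc a b, f x := by
  rw [← Ioc_union_Ioc_eq_Ioc ha hab, setIntegral_union (Ioc_disjoint_Ioc_of_le le_rfl)
    measurableSet_Ioc (hi.mono_set (Ioc_subset_Ioc_right hab))
    (hi.mono_set (Ioc_subset_Ioc_left ha))]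

/-- The primitive of an antitone function is concave. -/
theorem AntitoneOn.concaveOn_setIntegral (hf : AntitoneOn f (Ioi 0))
    (hi : ∀ b, IntegrableOn f (Ioc 0 b)) :
    ConcaveOn ℝ (Ioi 0) fun z => ∫ x in Ioc 0 z, f x := by
  refine concaveOn_of_slope_anti_adjacent (convex_Ioi 0) fun {x y z} hx hz hxy hyz => ?_
  have hx' : 0 < x := hx
  rw [setIntegral_Ioc_zero_add (by linarith) hyz.le (hi z),
    setIntegral_Ioc_zero_add hx'.le hxy.le (hi y)]
  have h1 := hf.mul_le_setIntegral_Ioc hx' hxy.le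
  have h2 := hf.setIntegral_Ioc_le_mul (hx'.trans hxy) hyz.le
  refine (?_ : _ ≤ f y).trans (?_ : f y ≤ _)
  · rw [div_le_iff₀ (by linarith)]
    linarith
  · rw [le_div_iff₀ (by linarith)]
    linarith

theorem iUnion_Ioc_geometric {z ρ : ℝ} (hz : 0 < z) (hρ : 0 < ρ) (hρ1 : ρ < 1) :
    ⋃ k : ℕ, Ioc (z * ρ ^ (k + 1)) (z * ρ ^ k) = Ioc 0 z := by
  ext x
  simp only [mem_iUnion, mem_Ioc]
  constructor
  · rintro ⟨k, h1, h2⟩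
    exact ⟨lt_trans (by positivity) h1,
      h2.trans (mul_le_of_le_one_right hz.le (pow_le_one₀ hρ.le hρ1.le))⟩
  · rintro ⟨h1, h2⟩
    obtain ⟨n, h3, h4⟩ := exists_nat_pow_near_of_lt_one (x := x / z) (y := ρ) (by positivity)
      ((div_le_one hz).2 h2) hρ hρ1
    rw [lt_div_iff₀ hz, mul_comm] at h3
    rw [div_le_iff₀ hz, mul_comm] at h4
    exact ⟨n, h3, h4⟩

theorem pairwise_disjoint_Ioc_geometric {z ρ : ℝ} (hz : 0 < z) (hρ : 0 < ρ) (hρ1 : ρ < 1) :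
    Pairwise (Function.onFun Disjoint fun k : ℕ => Ioc (z * ρ ^ (k + 1)) (z * ρ ^ k)) :=
  Antitone.pairwise_disjoint_on_Ioc_succ (f := fun k : ℕ => z * ρ ^ k)
    ((pow_right_anti₀ hρ.le hρ1.le).const_mul hz.le)

end AntitoneIntegral

/-! ### Convergence of the geometric sums and integrability -/

namespace IsConcaveKernel

variable {h : ℝ → ℝ} {ρ z : ℝ}

theorem integrableOn_of_summable (hh : IsConcaveKernel h) (hρ : 0 < ρ) (hρ1 : ρ < 1)
    (hz : 0 < z) (hs : Summable fun k : ℕ => perspective h (z * ρ ^ k)) :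
    IntegrableOn (fun y => h (1 / y)) (Ioc 0 z) := by
  rw [← iUnion_Ioc_geometric hz hρ hρ1]
  have hK := hh.antitoneOn_inv
  have hp : ∀ k : ℕ, 0 < z * ρ ^ k := fun k => by positivity
  have hle : ∀ k : ℕ, z * ρ ^ (k + 1) ≤ z * ρ ^ k := fun k => by
    have := pow_le_pow_of_le_one hρ.le hρ1.le k.le_succ
    gcongr
  have hi : ∀ k : ℕ, IntegrableOn (fun y => h (1 / y)) (Ioc (z * ρ ^ (k + 1)) (z * ρ ^ k)) :=
    fun k => hK.integrableOn_Ioc_of_pos (hp _)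
  refine integrableOn_iUnion_of_summable_integral_norm hi ?_
  have hs' := hs.abs
  have hs1 := (summable_nat_add_iff 1).2 hs'
  refine Summable.of_nonneg_of_le (fun k => integral_nonneg fun x => norm_nonneg _) (fun k => ?_)
    (((hs1.mul_left ρ⁻¹).add hs').mul_left (1 - ρ))
  have hb : ∀ y ∈ Ioc (z * ρ ^ (k + 1)) (z * ρ ^ k), ‖h (1 / y)‖ ≤
      |h (1 / (z * ρ ^ (k + 1)))| + |h (1 / (z * ρ ^ k))| := fun y hy => by
    have h1 := hK (hp (k + 1)) ((hp (k + 1)).trans hy.1) hy.1.le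
    have h2 := hK ((hp (k + 1)).trans hy.1) (hp k) hy.2
    simp only at h1 h2
    rw [Real.norm_eq_abs, abs_le]
    constructor
    · linarith [neg_abs_le (h (1 / (z * ρ ^ k))), abs_nonneg (h (1 / (z * ρ ^ (k + 1))))]
    · linarith [le_abs_self (h (1 / (z * ρ ^ (k + 1)))), abs_nonneg (h (1 / (z * ρ ^ k)))]
  have h3 := setIntegral_mono_on (μ := volume) (hi k).norm
    (integrableOn_const (by simp)) measurableSet_Ioc hb
  refine h3.trans (le_of_eq ?_)
  simp only [perspective, abs_mul, abs_of_pos (hp _), setIntegral_const, smul_eq_mul]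
  rw [Measure.real, Real.volume_Ioc, ENNReal.toReal_ofReal (by linarith [hle k])]
  rw [pow_succ]
  field_simp

theorem hasSum_setIntegral (hρ : 0 < ρ) (hρ1 : ρ < 1) (hz : 0 < z)
    (hi : IntegrableOn (fun y => h (1 / y)) (Ioc 0 z)) :
    HasSum (fun k : ℕ => ∫ y in Ioc (z * ρ ^ (k + 1)) (z * ρ ^ k), h (1 / y))
      (∫ y in Ioc 0 z, h (1 / y)) := by
  rw [← iUnion_Ioc_geometric hz hρ hρ1] at hi ⊢
  exact hasSum_integral_iUnion (fun _ => measurableSet_Ioc)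
    (pairwise_disjoint_Ioc_geometric hz hρ hρ1) hi

theorem mul_perspective_le_setIntegral (hh : IsConcaveKernel h) (hρ : 0 < ρ) (hρ1 : ρ < 1)
    (hz : 0 < z) (k : ℕ) : (1 - ρ) * perspective h (z * ρ ^ k) ≤
      ∫ y in Ioc (z * ρ ^ (k + 1)) (z * ρ ^ k), h (1 / y) := by
  have := hh.antitoneOn_inv.mul_le_setIntegral_Ioc (a := z * ρ ^ (k + 1)) (b := z * ρ ^ k)
    (by positivity) (mul_le_mul_of_nonneg_left
      (pow_le_pow_of_le_one hρ.le hρ1.le k.le_succ) hz.le)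
  refine le_trans (le_of_eq ?_) this
  rw [perspective, pow_succ]
  ring

theorem setIntegral_le_mul_perspective (hh : IsConcaveKernel h) (hρ : 0 < ρ) (hρ1 : ρ < 1)
    (hz : 0 < z) (k : ℕ) : ∫ y in Ioc (z * ρ ^ (k + 1)) (z * ρ ^ k), h (1 / y) ≤
      (1 - ρ) / ρ * perspective h (ρ * z * ρ ^ k) := by
  have := hh.antitoneOn_inv.setIntegral_Ioc_le_mul (a := z * ρ ^ (k + 1)) (b := z * ρ ^ k)
    (by positivity) (mul_le_mul_of_nonneg_left
      (pow_le_pow_of_le_one hρ.le hρ1.le k.le_succ) hz.le)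
  refine this.trans (le_of_eq ?_)
  have e : ρ * z * ρ ^ k = z * ρ ^ (k + 1) := by rw [pow_succ]; ring
  rw [perspective, e, pow_succ]
  field_simp

theorem geomSummable_of_integrableOn (hh : IsConcaveKernel h) (hρ : 0 < ρ) (hρ1 : ρ < 1)
    (hi : ∀ b, IntegrableOn (fun y => h (1 / y)) (Ioc 0 b)) : GeomSummable h ρ := by
  intro z hz
  have hs := (hasSum_setIntegral hρ hρ1 hz (hi z)).summable.mul_left (1 - ρ)⁻¹
  refine hs.of_norm_bounded_eventually_nat ?_
  have h2 : Tendsto (fun k : ℕ => z * ρ ^ k) atTop (𝓝 (z * 0)) :=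
    (tendsto_pow_atTop_nhds_zero_of_lt_one hρ.le hρ1).const_mul z
  rw [mul_zero] at h2
  filter_upwards [h2.eventually (ge_mem_nhds zero_lt_one)] with k hk
  rw [Real.norm_of_nonneg (hh.perspective_nonneg (by positivity) hk),
    ← div_eq_inv_mul, le_div_iff₀ (by linarith), mul_comm]
  exact hh.mul_perspective_le_setIntegral hρ hρ1 hz k

/-- The lower Riemann sums over geometric partitions. -/
theorem mul_geomSum_le_setIntegral (hh : IsConcaveKernel h) (hρ : 0 < ρ) (hρ1 : ρ < 1)
    (hz : 0 < z) (hi : ∀ b, IntegrableOn (fun y => h (1 / y)) (Ioc 0 b)) :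
    (1 - ρ) * geomSum h ρ z ≤ ∫ y in Ioc 0 z, h (1 / y) :=
  hasSum_le (hh.mul_perspective_le_setIntegral hρ hρ1 hz)
    ((hh.geomSummable_of_integrableOn hρ hρ1 hi z hz).hasSum.mul_left (1 - ρ))
    (hasSum_setIntegral hρ hρ1 hz (hi z))

/-- The upper Riemann sums over geometric partitions. -/
theorem setIntegral_le_mul_geomSum (hh : IsConcaveKernel h) (hρ : 0 < ρ) (hρ1 : ρ < 1)
    (hz : 0 < z) (hi : ∀ b, IntegrableOn (fun y => h (1 / y)) (Ioc 0 b)) :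
    ∫ y in Ioc 0 z, h (1 / y) ≤ (1 - ρ) / ρ * geomSum h ρ (ρ * z) :=
  hasSum_le (hh.setIntegral_le_mul_perspective hρ hρ1 hz)
    (hasSum_setIntegral hρ hρ1 hz (hi z))
    ((hh.geomSummable_of_integrableOn hρ hρ1 hi (ρ * z) (by positivity)).hasSum.mul_left _)

theorem exists_geomSum_pos_of_setIntegral_pos (hh : IsConcaveKernel h) (hz : 0 < z)
    (hi : ∀ b, IntegrableOn (fun y => h (1 / y)) (Ioc 0 b))
    (hpos : 0 < ∫ y in Ioc 0 z, h (1 / y)) : ∃ ρ, 0 < ρ ∧ ρ < 1 ∧ 0 < geomSum h ρ z := by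
  have ht : Tendsto (fun ρ : ℝ => ρ * (∫ y in Ioc 0 z, h (1 / y)) + (1 - ρ) * perspective h z)
      (𝓝[<] 1) (𝓝 (1 * (∫ y in Ioc 0 z, h (1 / y)) + (1 - 1) * perspective h z)) :=
    ((by fun_prop : Continuous fun ρ : ℝ =>
      ρ * (∫ y in Ioc 0 z, h (1 / y)) + (1 - ρ) * perspective h z).tendsto 1).mono_left
        nhdsWithin_le_nhds
  have hev := ht.eventually (lt_mem_nhds (a := 0) (by simpa using hpos))
  have hI : ∀ᶠ ρ : ℝ in 𝓝[<] 1, ρ ∈ Ioo (0 : ℝ) 1 := Ioo_mem_nhdsLT one_pos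
  obtain ⟨ρ, h1, h2, h3⟩ := (hev.and hI).exists
  refine ⟨ρ, h2, h3, ?_⟩
  have key := hh.setIntegral_le_mul_geomSum h2 h3 hz hi
  have e := (hh.geomSummable_of_integrableOn h2 h3 hi).geomSum_eq_add hz
  have e2 : (1 - ρ) * geomSum h ρ (ρ * z) = (1 - ρ) * geomSum h ρ z -
      (1 - ρ) * perspective h z := by rw [e]; ring
  have key2 := mul_le_mul_of_nonneg_left key h2.le
  rw [div_mul_eq_mul_div, mul_div_cancel₀ _ h2.ne', e2] at key2
  have : 0 < (1 - ρ) * geomSum h ρ z := by linarith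
  exact pos_of_mul_pos_right this (by linarith)

theorem setIntegral_pos (hh : IsConcaveKernel h)
    (hi : ∀ b, IntegrableOn (fun y => h (1 / y)) (Ioc 0 b)) (hz : 0 < z) (hz1 : z ≤ 1) :
    0 < ∫ y in Ioc 0 z, h (1 / y) := by
  have h2 : (0 : ℝ) < 1 / 2 := by norm_num
  have h3 : (1 / 2 : ℝ) < 1 := by norm_num
  have h1 := hh.geomSum_pos h2 h3 (hh.geomSummable_of_integrableOn h2 h3 hi) hz hz1
  linarith [hh.mul_geomSum_le_setIntegral h2 h3 hz hi]

theorem exists_setIntegral_neg (hh : IsConcaveKernel h)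
    (hi : ∀ b, IntegrableOn (fun y => h (1 / y)) (Ioc 0 b)) :
    ∃ z, 0 < z ∧ ∫ y in Ioc 0 z, h (1 / y) < 0 := by
  have h2 : (0 : ℝ) < 1 / 2 := by norm_num
  have h3 : (1 / 2 : ℝ) < 1 := by norm_num
  obtain ⟨z, hz, hneg⟩ := hh.exists_geomSum_neg h2 h3 (hh.geomSummable_of_integrableOn h2 h3 hi)
  refine ⟨2 * z, by positivity, ?_⟩
  have := hh.setIntegral_le_mul_geomSum h2 h3 (z := 2 * z) (by positivity) hi
  rw [show 1 / 2 * (2 * z) = z by ring] at this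
  linarith

end IsConcaveKernel

theorem setIntegral_inv_mul (h : ℝ → ℝ) {c : ℝ} (hc : 0 < c) :
    ∫ x in Ioc (0 : ℝ) 1, h (1 / (c * x)) = c⁻¹ * ∫ y in Ioc 0 c, h (1 / y) := by
  rw [← intervalIntegral.integral_of_le zero_le_one, ← intervalIntegral.integral_of_le hc.le]
  have := intervalIntegral.integral_comp_mul_left (a := 0) (b := 1) (fun y => h (1 / y)) hc.ne'
  simpa using this

theorem integrableOn_inv_mul {h : ℝ → ℝ} {c : ℝ} (hc : 0 < c)
    (hi : IntegrableOn (fun y => h (1 / y)) (Ioc 0 c)) :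
    IntegrableOn (fun x => h (1 / (c * x))) (Ioc 0 1) := by
  have h1 : IntervalIntegrable (fun y => h (1 / y)) volume 0 c :=
    (intervalIntegrable_iff_integrableOn_Ioc_of_le hc.le).2 hi
  have h2 := h1.comp_mul_left (c := c)
  rw [zero_div, div_self hc.ne'] at h2
  exact (intervalIntegrable_iff_integrableOn_Ioc_of_le zero_le_one).1 h2

/-! ### Weight sequences and their partial sums -/

/-- The partial sum `w₀ + ⋯ + wₙ`. -/
def cumSum (w : ℕ → ℝ) (n : ℕ) : ℝ := ∑ i ∈ Finset.range (n + 1), w i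

/-- Positive weights with divergent sum whose ratios to the partial sums do not increase. -/
structure IsHardyWeight (w : ℕ → ℝ) : Prop where
  pos : ∀ n, 0 < w n
  tendsto : Tendsto (cumSum w) atTop atTop
  antitone : Antitone fun n => w n / cumSum w n

/-- The weight carried by the indices `j ≤ n` with `Λⱼ ≤ x`. -/
noncomputable def massBelow (w : ℕ → ℝ) (n : ℕ) (x : ℝ) : ℝ :=
  ∑ j ∈ Finset.range (n + 1) with cumSum w j ≤ x, w j

/-- The points `Λⱼ / Λₙ` with weights `wⱼ / Λₙ` asymptotically put mass `ρᵏ` on `[0, ρᵏ]`. -/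
def HasGeometricMass (w : ℕ → ℝ) (ρ : ℝ) : Prop :=
  ∀ k : ℕ, Tendsto (fun n => massBelow w n (ρ ^ k * cumSum w n) / cumSum w n) atTop (𝓝 (ρ ^ k))

theorem cumSum_zero (w : ℕ → ℝ) : cumSum w 0 = w 0 := by simp [cumSum]

theorem cumSum_succ (w : ℕ → ℝ) (n : ℕ) : cumSum w (n + 1) = cumSum w n + w (n + 1) :=
  Finset.sum_range_succ _ _

/-- A vanishing weight would force all later ones to vanish, and the partial sums to be bounded. -/
theorem isHardyWeight_of_nonneg {w : ℕ → ℝ} (hw0 : 0 < w 0) (hw : ∀ n, 0 ≤ w n)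
    (hW : Tendsto (cumSum w) atTop atTop) (hanti : Antitone fun n => w n / cumSum w n) :
    IsHardyWeight w := by
  have hL : ∀ n, 0 < cumSum w n := fun n =>
    Finset.sum_pos' (fun i _ => hw i) ⟨0, by simp, hw0⟩
  refine ⟨fun n => (hw n).lt_of_ne' fun h0 => ?_, hW, hanti⟩
  have hz : ∀ m, n ≤ m → w m = 0 := fun m hm => by
    have := hanti hm
    simp only [h0, zero_div] at this
    exact le_antisymm (by simpa using (div_le_iff₀ (hL m)).1 this) (hw m)
  have hc : ∀ m, cumSum w (n + m) = cumSum w n := fun m => by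
    induction m with
    | zero => rfl
    | succ m ih => rw [← add_assoc, cumSum_succ, ih, hz _ (by omega), add_zero]
  obtain ⟨N, hN⟩ := eventually_atTop.1 (hW.eventually_gt_atTop (cumSum w n))
  exact (hN (n + N) (by omega)).ne' (hc N)

namespace IsHardyWeight

variable {w : ℕ → ℝ}

theorem cumSum_pos (hw : IsHardyWeight w) (n : ℕ) : 0 < cumSum w n :=
  Finset.sum_pos (fun i _ => hw.pos i) (by simp)

theorem strictMono_cumSum (hw : IsHardyWeight w) : StrictMono (cumSum w) :=
  strictMono_nat_of_lt_succ fun n => by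
    rw [cumSum_succ]
    linarith [hw.pos (n + 1)]

theorem le_cumSum (hw : IsHardyWeight w) (n : ℕ) : w n ≤ cumSum w n :=
  Finset.single_le_sum (f := w) (fun i _ => (hw.pos i).le) (by simp)

/-- The weighted sum of the ratios `wₙ / Λₙ` diverges, since `log Λₙ` grows by at most a constant
multiple of `wₙ / Λₙ`. -/
theorem tendsto_cumSum_ratio (hw : IsHardyWeight w) :
    Tendsto (fun n => ∑ j ∈ Finset.range (n + 1), w j / cumSum w j) atTop atTop := by
  set M := cumSum w 1 / cumSum w 0 with hM
  have hM0 : 0 < M := div_pos (hw.cumSum_pos 1) (hw.cumSum_pos 0)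
  have hratio : ∀ n, cumSum w (n + 1) / cumSum w n ≤ M := fun n => by
    have h1 := hw.antitone (show 1 ≤ n + 1 by omega)
    have p0 := hw.cumSum_pos 0
    have p1 := hw.cumSum_pos 1
    have pn := hw.cumSum_pos n
    have pn1 := hw.cumSum_pos (n + 1)
    simp only at h1
    rw [div_le_div_iff₀ pn1 p1] at h1
    have e1 := cumSum_succ w n
    have e2 := cumSum_succ w 0
    rw [zero_add] at e2
    rw [hM, div_le_div_iff₀ pn p0]
    have e3 : w (n + 1) = cumSum w (n + 1) - cumSum w n := by linarith
    have e4 : w 1 = cumSum w 1 - cumSum w 0 := by linarith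
    rw [e3, e4] at h1
    linarith
  have hlog : ∀ n, Real.log (cumSum w n) - Real.log (cumSum w 0) ≤
      M * ∑ j ∈ Finset.range (n + 1), w j / cumSum w j := by
    intro n
    induction n with
    | zero =>
      have := div_pos (hw.pos 0) (hw.cumSum_pos 0)
      simp only [sub_self, zero_add, Finset.sum_range_one]
      positivity
    | succ n ih =>
      have pn := hw.cumSum_pos n
      have pn1 := hw.cumSum_pos (n + 1)
      rw [Finset.sum_range_succ, mul_add]
      have h1 := Real.log_le_sub_one_of_pos (div_pos pn1 pn)
      rw [Real.log_div pn1.ne' pn.ne'] at h1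
      have h2 : cumSum w (n + 1) / cumSum w n - 1 ≤ M * (w (n + 1) / cumSum w (n + 1)) := by
        have e : cumSum w (n + 1) / cumSum w n - 1 =
            cumSum w (n + 1) / cumSum w n * (w (n + 1) / cumSum w (n + 1)) := by
          rw [cumSum_succ] at pn1 ⊢
          field_simp
          ring
        rw [e]
        exact mul_le_mul_of_nonneg_right (hratio n) (div_pos (hw.pos _) pn1).le
      linarith
  have h1 : Tendsto (fun n => Real.log (cumSum w n) - Real.log (cumSum w 0)) atTop atTop :=
    tendsto_atTop_add_const_right _ _ (Real.tendsto_log_atTop.comp hw.tendsto)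
  exact (tendsto_const_mul_atTop_of_pos hM0).1 (tendsto_atTop_mono hlog h1)

theorem massBelow_of_le (hw : IsHardyWeight w) {n : ℕ} {x : ℝ} (h : cumSum w n ≤ x) :
    massBelow w n x = cumSum w n := by
  rw [massBelow, Finset.filter_true_of_mem, cumSum]
  intro j hj
  exact (hw.strictMono_cumSum.monotone (Finset.mem_range_succ_iff.1 hj)).trans h

theorem massBelow_succ_of_lt {n : ℕ} {x : ℝ} (h : x < cumSum w (n + 1)) :
    massBelow w (n + 1) x = massBelow w n x := by
  rw [massBelow, Finset.range_add_one, Finset.filter_insert, if_neg (by linarith), massBelow]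

/-- If `Λₘ ≤ x < Λₘ₊₁` then exactly the indices up to `m` lie below `x`. -/
theorem massBelow_eq (hw : IsHardyWeight w) {m : ℕ} {x : ℝ} (h : cumSum w m ≤ x)
    (h' : x < cumSum w (m + 1)) (k : ℕ) : massBelow w (m + k) x = cumSum w m := by
  induction k with
  | zero => exact hw.massBelow_of_le h
  | succ k ih =>
    rw [← add_assoc, massBelow_succ_of_lt, ih]
    exact h'.trans_le (hw.strictMono_cumSum.monotone (by omega))

theorem massBelow_le (hw : IsHardyWeight w) {x : ℝ} (hx : 0 ≤ x) (n : ℕ) :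
    massBelow w n x ≤ x := by
  induction n with
  | zero =>
    by_cases h : cumSum w 0 ≤ x
    · rwa [hw.massBelow_of_le h]
    · rw [massBelow, Finset.filter_false_of_mem]
      · simpa using hx
      · intro j hj
        rwa [show j = 0 by simpa using hj]
  | succ n ih =>
    by_cases h : cumSum w (n + 1) ≤ x
    · rwa [hw.massBelow_of_le h]
    · rwa [massBelow_succ_of_lt (not_le.1 h)]

theorem sub_le_massBelow (hw : IsHardyWeight w) {x B : ℝ} (n : ℕ)
    (hB : ∀ j ≤ n, w j ≤ B) : min x (cumSum w n) - B ≤ massBelow w n x := by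
  induction n with
  | zero =>
    by_cases h : cumSum w 0 ≤ x
    · rw [hw.massBelow_of_le h]
      linarith [min_le_right x (cumSum w 0), hB 0 le_rfl, hw.pos 0]
    · have h0 : 0 ≤ massBelow w 0 x := Finset.sum_nonneg fun i _ => (hw.pos i).le
      linarith [min_le_right x (cumSum w 0), hB 0 le_rfl, cumSum_zero w]
  | succ n ih =>
    have hB' := hB (n + 1) le_rfl
    have hp := hw.pos (n + 1)
    by_cases h : cumSum w (n + 1) ≤ x
    · rw [hw.massBelow_of_le h]
      linarith [min_le_right x (cumSum w (n + 1))]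
    · rw [massBelow_succ_of_lt (not_le.1 h)]
      by_cases h' : cumSum w n ≤ x
      · rw [hw.massBelow_of_le h']
        linarith [min_le_right x (cumSum w (n + 1)), cumSum_succ w n]
      · have := ih fun j hj => hB j (by omega)
        rw [min_eq_left (not_le.1 h').le] at this
        rwa [min_eq_left (not_le.1 h).le]

/-- When the ratios tend to `0`, the points `Λⱼ / Λₙ` become equidistributed in `[0, 1]`. -/
theorem hasGeometricMass_of_tendsto_zero (hw : IsHardyWeight w)
    (hlim : Tendsto (fun n => w n / cumSum w n) atTop (𝓝 0)) {ρ : ℝ} (hρ : 0 < ρ)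
    (hρ1 : ρ < 1) : HasGeometricMass w ρ := by
  intro k
  have hs0 : 0 < ρ ^ k := by positivity
  have hs1 : ρ ^ k ≤ 1 := pow_le_one₀ hρ.le hρ1.le
  set s := ρ ^ k
  refine tendsto_order.2 ⟨fun a ha => ?_, fun a ha => Eventually.of_forall fun n => ?_⟩
  · obtain ⟨J, hJ⟩ := eventually_atTop.1 (hlim.eventually (gt_mem_nhds (sub_pos.2 ha)))
    have hbig : Tendsto (fun n => (s - a) * cumSum w n) atTop atTop :=
      hw.tendsto.const_mul_atTop (sub_pos.2 ha)
    filter_upwards [hbig.eventually_gt_atTop (cumSum w J)] with n hn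
    have pn := hw.cumSum_pos n
    have hB : ∀ j ≤ n, w j < (s - a) * cumSum w n := fun j hj => by
      rcases le_total j J with h | h
      · exact (((hw.le_cumSum j).trans (hw.strictMono_cumSum.monotone h))).trans_lt hn
      · refine ((div_lt_iff₀ (hw.cumSum_pos j)).1 (hJ j h)).trans_le ?_
        exact mul_le_mul_of_nonneg_left (hw.strictMono_cumSum.monotone hj) (sub_pos.2 ha).le
    obtain ⟨j, hj, hmax⟩ := Finset.exists_max_image (Finset.range (n + 1)) w (by simp)
    have := hw.sub_le_massBelow (x := s * cumSum w n) n
      fun i hi => hmax i (Finset.mem_range_succ_iff.2 hi)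
    rw [min_eq_left (mul_le_of_le_one_left pn.le hs1)] at this
    rw [lt_div_iff₀ pn]
    linarith [hB j (Finset.mem_range_succ_iff.1 hj)]
  · refine lt_of_le_of_lt ?_ ha
    rw [div_le_iff₀ (hw.cumSum_pos n)]
    exact hw.massBelow_le (by have := hw.cumSum_pos n; positivity) n

theorem cumSum_le_pow_mul (hw : IsHardyWeight w) {η : ℝ} (hη1 : η < 1)
    (hle : ∀ n, η ≤ w n / cumSum w n) (m k : ℕ) :
    cumSum w m ≤ (1 - η) ^ k * cumSum w (m + k) := by
  induction k with
  | zero => simp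
  | succ k ih =>
    refine ih.trans ?_
    rw [pow_succ, mul_assoc]
    refine mul_le_mul_of_nonneg_left ?_ (pow_nonneg (by linarith) _)
    have h1 := hle (m + (k + 1))
    rw [le_div_iff₀ (hw.cumSum_pos _), ← add_assoc] at h1
    rw [← add_assoc]
    linarith [cumSum_succ w (m + k)]

theorem tendsto_cumSum_div (hw : IsHardyWeight w) {η : ℝ}
    (hlim : Tendsto (fun n => w n / cumSum w n) atTop (𝓝 η)) (k : ℕ) :
    Tendsto (fun m => cumSum w m / cumSum w (m + k)) atTop (𝓝 ((1 - η) ^ k)) := by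
  induction k with
  | zero =>
    simp only [add_zero, pow_zero]
    refine tendsto_const_nhds.congr fun m => (div_self (hw.cumSum_pos m).ne').symm
  | succ k ih =>
    rw [pow_succ]
    have h1 : Tendsto (fun m => 1 - w (m + (k + 1)) / cumSum w (m + (k + 1))) atTop
        (𝓝 (1 - η)) := tendsto_const_nhds.sub ((tendsto_add_atTop_iff_nat (k + 1)).2 hlim)
    refine (ih.mul h1).congr fun m => ?_
    have p1 := hw.cumSum_pos (m + k)
    have p2 := hw.cumSum_pos (m + (k + 1))
    have e : w (m + (k + 1)) = cumSum w (m + (k + 1)) - cumSum w (m + k) := by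
      rw [← add_assoc, cumSum_succ]
      ring
    rw [e]
    field_simp
    ring

/-- When the ratios tend to `η > 0`, the mass concentrates near the powers of `1 - η`. -/
theorem hasGeometricMass_of_tendsto_pos (hw : IsHardyWeight w) {η : ℝ} (hη : 0 < η)
    (hη1 : η < 1) (hlim : Tendsto (fun n => w n / cumSum w n) atTop (𝓝 η)) :
    HasGeometricMass w (1 - η) := by
  intro k
  have hle : ∀ n, η ≤ w n / cumSum w n := fun n => hw.antitone.le_of_tendsto hlim n
  rw [← tendsto_add_atTop_iff_nat k]
  refine (hw.tendsto_cumSum_div hlim k).congr' ?_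
  rcases k with _ | k
  · refine Eventually.of_forall fun m => ?_
    simp only [add_zero, pow_zero, one_mul]
    rw [hw.massBelow_of_le le_rfl]
  have h1 : (1 - η) ^ (k + 1) < (1 - η) ^ k :=
    pow_lt_pow_right_of_lt_one₀ (by linarith) (by linarith) (by omega)
  have h2 := (tendsto_add_atTop_iff_nat 1).2 (hw.tendsto_cumSum_div hlim k)
  filter_upwards [h2.eventually (lt_mem_nhds h1)] with m hm
  rw [lt_div_iff₀ (hw.cumSum_pos _)] at hm
  rw [hw.massBelow_eq (hw.cumSum_le_pow_mul hη1 hle m (k + 1))]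
  rwa [show m + (k + 1) = m + 1 + k by ring]

/-- The sums over the partition of `(0, Λₙ / X]` by the points `Λⱼ / X` are at most the geometric
sum whose ratio is at least all the ratios of consecutive points. -/
theorem sum_perspective_le_geomSum (hw : IsHardyWeight w) {h : ℝ → ℝ} (hh : IsConcaveKernel h)
    {ρ : ℝ} (hρ : 0 < ρ) (hρ1 : ρ < 1) (hs : GeomSummable h ρ) {X : ℝ} (hX : 0 < X) (n : ℕ)
    (hr : ∀ j ≤ n, 1 - ρ ≤ w j / cumSum w j) :
    ∑ j ∈ Finset.range (n + 1), w j / cumSum w j * perspective h (cumSum w j / X) ≤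
      (1 - ρ) * geomSum h ρ (cumSum w n / X) := by
  induction n with
  | zero =>
    have hz : 0 < cumSum w 0 / X := div_pos (hw.cumSum_pos 0) hX
    set z := cumSum w 0 / X
    rw [zero_add, Finset.sum_range_one, ← cumSum_zero w, div_self (hw.cumSum_pos 0).ne', one_mul]
    have hgeom := (hasSum_geometric_of_lt_one hρ.le hρ1).mul_right (perspective h z)
    have hle : (1 - ρ)⁻¹ * perspective h z ≤ geomSum h ρ z := by
      refine hasSum_le (fun k => ?_) hgeom (hs z hz).hasSum
      have hk : 0 < z * ρ ^ k := by positivity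
      have := hh.antitoneOn_inv hk hz (mul_le_of_le_one_right hz.le (pow_le_one₀ hρ.le hρ1.le))
      simp only at this
      rw [perspective, perspective]
      calc ρ ^ k * (z * h (1 / z)) = z * ρ ^ k * h (1 / z) := by ring
        _ ≤ _ := mul_le_mul_of_nonneg_left this hk.le
    have h1 : 0 < 1 - ρ := by linarith
    rwa [← inv_mul_le_iff₀ h1]
  | succ n ih =>
    rw [Finset.sum_range_succ]
    refine (add_le_add_left (ih fun j hj => hr j (by omega)) _).trans ?_
    have p1 := hw.cumSum_pos (n + 1)
    have p0 := hw.cumSum_pos n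
    set z := cumSum w (n + 1) / X with hzdef
    have hz : 0 < z := div_pos p1 hX
    set r := cumSum w n / cumSum w (n + 1) with hrdef
    have hr0 : 0 < r := div_pos p0 p1
    have e1 : w (n + 1) / cumSum w (n + 1) = 1 - r := by
      rw [hrdef, eq_sub_iff_add_eq, ← add_div, add_comm, ← cumSum_succ, div_self p1.ne']
    have e2 : cumSum w n / X = r * z := by rw [hrdef, hzdef]; field_simp
    have hrρ : r ≤ ρ := by
      have := hr (n + 1) le_rfl
      linarith
    rw [e1, e2]
    have hs1 := (hs z hz).hasSum
    have hs2 := (hs (r * z) (by positivity)).hasSum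
    have hs3 := (hs (ρ * z) (by positivity)).hasSum
    have key := hasSum_le (fun k => hh.perspective_three_point hr0 hrρ hρ1
      (show 0 < z * ρ ^ k by positivity))
      (((hs2.congr_fun fun k => by ring_nf).mul_left (1 - ρ)).add (hs1.mul_left (ρ - r)))
      ((hs3.congr_fun fun k => by ring_nf).mul_left (1 - r))
    have e3 := hs.geomSum_eq_add hz
    have e4 : ∑' k : ℕ, perspective h (z * ρ ^ k) = geomSum h ρ z := rfl
    have e5 : ∑' k : ℕ, perspective h (r * z * ρ ^ k) = geomSum h ρ (r * z) := rfl
    have e6 : ∑' k : ℕ, perspective h (ρ * z * ρ ^ k) = geomSum h ρ (ρ * z) := rfl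
    rw [e4, e5, e6] at key
    linear_combination key - (1 - r) * e3

end IsHardyWeight

/-! ### A mixed-mean inequality for concave deviations -/

/-- A concave function `e` on `I × I` with the sign of `x - y`, where the interval `I` starts at
`0`, that vanishes asymptotically along the rays through the origin. -/
structure IsConcaveDeviation (I : Set ℝ) (e : ℝ → ℝ → ℝ) : Prop where
  convex : Convex ℝ I
  nonneg : ∀ x ∈ I, 0 ≤ x
  exists_Ioc_subset : ∃ b, 0 < b ∧ Ioc 0 b ⊆ I
  concaveOn : ConcaveOn ℝ (I ×ˢ I) fun p : ℝ × ℝ => e p.1 p.2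
  pos : ∀ x ∈ I, ∀ y ∈ I, y < x → 0 < e x y
  neg : ∀ x ∈ I, ∀ y ∈ I, x < y → e x y < 0
  diag : ∀ x ∈ I, e x x = 0
  tendsto_zero : ∀ x, 0 < x → Tendsto (fun t => e (x * t) t) (𝓝[>] 0) (𝓝 0)

/-- The `w`-weighted arithmetic mean of `x₀, …, xₙ`. -/
noncomputable def cumMean (w x : ℕ → ℝ) (n : ℕ) : ℝ :=
  (∑ i ∈ Finset.range (n + 1), w i * x i) / cumSum w n

section CumMean

variable {w x : ℕ → ℝ}

theorem IsHardyWeight.cumSum_mul_cumMean (hw : IsHardyWeight w) (n : ℕ) :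
    cumSum w n * cumMean w x n = ∑ i ∈ Finset.range (n + 1), w i * x i := by
  rw [cumMean, mul_div_cancel₀ _ (hw.cumSum_pos n).ne']

theorem IsHardyWeight.cumSum_mul_cumMean_succ (hw : IsHardyWeight w) (n : ℕ) :
    cumSum w (n + 1) * cumMean w x (n + 1) =
      cumSum w n * cumMean w x n + w (n + 1) * x (n + 1) := by
  rw [hw.cumSum_mul_cumMean, hw.cumSum_mul_cumMean, Finset.sum_range_succ]

theorem IsHardyWeight.cumMean_zero (hw : IsHardyWeight w) : cumMean w x 0 = x 0 := by
  have := (hw.pos 0).ne'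
  simp [cumMean, cumSum]
  field_simp

theorem IsHardyWeight.cumMean_mem (hw : IsHardyWeight w) {I : Set ℝ} (hI : Convex ℝ I)
    (hx : ∀ n, x n ∈ I) (n : ℕ) : cumMean w x n ∈ I := by
  have := hI.centerMass_mem (t := Finset.range (n + 1)) (w := w) (z := x)
    (fun i _ => (hw.pos i).le) (hw.cumSum_pos n) (fun i _ => hx i)
  convert this using 1
  rw [Finset.centerMass, cumMean, cumSum, div_eq_inv_mul]
  simp

end CumMean

/-- Jensen's inequality for three points of `I × I`, without normalization of the weights. -/
theorem IsConcaveDeviation.jensen_three {I : Set ℝ} {e : ℝ → ℝ → ℝ} (he : IsConcaveDeviation I e)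
    {p q r s x₁ x₂ x₃ y₁ y₂ y₃ X Y : ℝ} (hp : 0 ≤ p) (hq : 0 ≤ q) (hr : 0 ≤ r) (hs : 0 < s)
    (hsum : p + q + r = s) (hx₁ : x₁ ∈ I) (hx₂ : x₂ ∈ I) (hx₃ : x₃ ∈ I) (hy₁ : y₁ ∈ I)
    (hy₂ : y₂ ∈ I) (hy₃ : y₃ ∈ I) (hX : p * x₁ + q * x₂ + r * x₃ = s * X)
    (hY : p * y₁ + q * y₂ + r * y₃ = s * Y) :
    p * e x₁ y₁ + q * e x₂ y₂ + r * e x₃ y₃ ≤ s * e X Y := by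
  have key := he.concaveOn.le_map_sum (t := Finset.univ) (w := ![p / s, q / s, r / s])
    (p := ![(x₁, y₁), (x₂, y₂), (x₃, y₃)])
    (by
      intro i _
      fin_cases i
      · exact div_nonneg hp hs.le
      · exact div_nonneg hq hs.le
      · exact div_nonneg hr hs.le)
    (by
      simp [Fin.sum_univ_three]
      field_simp
      exact hsum)
    (by
      intro i _
      fin_cases i
      · exact ⟨hx₁, hy₁⟩
      · exact ⟨hx₂, hy₂⟩
      · exact ⟨hx₃, hy₃⟩)
  simp only [Fin.sum_univ_three, Matrix.cons_val_zero, Matrix.cons_val_one, Matrix.cons_val,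
    smul_eq_mul, Prod.smul_mk, Prod.mk_add_mk] at key
  have eX : p / s * x₁ + q / s * x₂ + r / s * x₃ = X := by
    field_simp
    linarith
  have eY : p / s * y₁ + q / s * y₂ + r / s * y₃ = Y := by
    field_simp
    linarith
  rw [eX, eY] at key
  have := mul_le_mul_of_nonneg_left key hs.le
  refine le_trans (le_of_eq ?_) this
  field_simp

/-- A weighted form of Kedlaya's inequality: if each `yₙ` is at most the deviation mean of `x₀, …,
xₙ`, then the arithmetic mean of `y₀, …, yₙ` is at most the deviation mean of the arithmetic means
of `x`. In the inductive step, with `θ = wₙ₊₁ / Λₙ₊₁`, `Z` and `Y` the old and the new mean of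
`y`, and `Aⱼ` the mean of `x₀, …, xⱼ`, the point `wⱼ (Aⱼ, Y)` is split into `(wⱼ - θ Λⱼ) (Aⱼ, Z)`,
`θ Λⱼ₋₁ (Aⱼ₋₁, Z)` and `θ wⱼ (xⱼ, yₙ₊₁)`; the first coefficient is nonnegative since the ratios
`wⱼ / Λⱼ` do not increase. -/
theorem IsConcaveDeviation.sum_cumMean_nonneg {I : Set ℝ} {e : ℝ → ℝ → ℝ}
    (he : IsConcaveDeviation I e) {w : ℕ → ℝ} (hw : IsHardyWeight w) {x y : ℕ → ℝ}
    (hx : ∀ n, x n ∈ I) (hy : ∀ n, y n ∈ I)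
    (hxy : ∀ n, 0 ≤ ∑ j ∈ Finset.range (n + 1), w j * e (x j) (y n)) (n : ℕ) :
    0 ≤ ∑ j ∈ Finset.range (n + 1), w j * e (cumMean w x j) (cumMean w y n) := by
  have hA := hw.cumMean_mem he.convex hx
  have hB := hw.cumMean_mem he.convex hy
  induction n with
  | zero => simpa [hw.cumMean_zero] using hxy 0
  | succ n ih =>
    have pn := hw.cumSum_pos (n + 1)
    set θ := w (n + 1) / cumSum w (n + 1) with hθ
    have hθ0 : 0 < θ := div_pos (hw.pos _) pn
    have hθL : θ * cumSum w (n + 1) = w (n + 1) := div_mul_cancel₀ _ pn.ne'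
    set Z := cumMean w y n with hZ
    set Y := cumMean w y (n + 1) with hY
    have hYZ : Y = (1 - θ) * Z + θ * y (n + 1) := by
      have h1 := hw.cumSum_mul_cumMean_succ (x := y) n
      have h2 := cumSum_succ w n
      rw [← hZ, ← hY] at h1
      have h3 : cumSum w n = cumSum w (n + 1) * (1 - θ) := by linarith
      rw [h3, ← hθL] at h1
      have : cumSum w (n + 1) * Y = cumSum w (n + 1) * ((1 - θ) * Z + θ * y (n + 1)) := by
        linarith
      exact mul_left_cancel₀ pn.ne' this
    have hterm : ∀ j ∈ Finset.range (n + 1 + 1),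
        (w j - θ * cumSum w j) * e (cumMean w x j) Z +
          θ * (cumSum w j - w j) * e (cumMean w x (j - 1)) Z +
          θ * w j * e (x j) (y (n + 1)) ≤ w j * e (cumMean w x j) Y := by
      intro j hj
      have hj' : j ≤ n + 1 := Finset.mem_range_succ_iff.1 hj
      have h1 : 0 ≤ w j - θ * cumSum w j := by
        have := hw.antitone hj'
        simp only [← hθ] at this
        rw [le_div_iff₀ (hw.cumSum_pos j)] at this
        linarith
      refine he.jensen_three h1 (mul_nonneg hθ0.le (by linarith [hw.le_cumSum j]))
        (mul_nonneg hθ0.le (hw.pos j).le) (hw.pos j) (by ring) (hA j) (hA _) (hx j) (hB n) (hB n)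
        (hy _) ?_ ?_
      · rcases j with _ | j
        · have e0 : cumSum w 0 = w 0 := cumSum_zero w
          have e1 : cumMean w x 0 = x 0 := hw.cumMean_zero
          rw [e0, e1]
          ring
        · have h2 := hw.cumSum_mul_cumMean_succ (x := x) j
          have h3 := cumSum_succ w j
          have h4 : cumSum w (j + 1) - w (j + 1) = cumSum w j := by linarith
          rw [h4, Nat.add_sub_cancel]
          linear_combination (-θ) * h2
      · rw [hYZ]
        ring
    refine le_trans ?_ (Finset.sum_le_sum hterm)
    rw [Finset.sum_add_distrib, Finset.sum_add_distrib]
    -- the terms with `θ Λⱼ` telescope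
    have e1 : ∑ j ∈ Finset.range (n + 1 + 1), (w j - θ * cumSum w j) * e (cumMean w x j) Z =
        ∑ j ∈ Finset.range (n + 1), w j * e (cumMean w x j) Z -
        ∑ j ∈ Finset.range (n + 1), θ * cumSum w j * e (cumMean w x j) Z := by
      rw [Finset.sum_range_succ, hθL, sub_self, zero_mul, add_zero, ← Finset.sum_sub_distrib]
      exact Finset.sum_congr rfl fun j _ => by ring
    have e2 : ∑ j ∈ Finset.range (n + 1 + 1),
        θ * (cumSum w j - w j) * e (cumMean w x (j - 1)) Z =
        ∑ j ∈ Finset.range (n + 1), θ * cumSum w j * e (cumMean w x j) Z := by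
      rw [Finset.sum_range_succ', cumSum_zero, sub_self, mul_zero, zero_mul, add_zero]
      refine Finset.sum_congr rfl fun j _ => ?_
      rw [cumSum_succ, Nat.add_sub_cancel, add_sub_cancel_right]
    have e3 : ∑ j ∈ Finset.range (n + 1 + 1), θ * w j * e (x j) (y (n + 1)) =
        θ * ∑ j ∈ Finset.range (n + 1 + 1), w j * e (x j) (y (n + 1)) := by
      rw [Finset.mul_sum]
      exact Finset.sum_congr rfl fun j _ => by ring
    rw [e1, e2, e3]
    have := mul_nonneg hθ0.le (hxy (n + 1))
    linarith

/-! ### Homogenization of concave deviations -/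

/-- `h` is the homogenization of `e`, `h(x) = lim e(x t, t) / t` as `t` decreases to `0`. -/
def HasHomogenization (e : ℝ → ℝ → ℝ) (h : ℝ → ℝ) : Prop :=
  ∀ x, 0 < x → Tendsto (fun t => t⁻¹ * e (x * t) t) (𝓝[>] 0) (𝓝 (h x))

namespace IsConcaveDeviation

variable {I : Set ℝ} {e : ℝ → ℝ → ℝ}

theorem smul_mem (he : IsConcaveDeviation I e) {x s : ℝ} (hx : x ∈ I) (hx0 : 0 < x) (hs : 0 < s)
    (hs1 : s ≤ 1) : s * x ∈ I := by
  obtain ⟨b, hb, hbI⟩ := he.exists_Ioc_subset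
  rcases le_total (s * x) b with h | h
  · exact hbI ⟨by positivity, h⟩
  · exact he.convex.ordConnected.out (hbI ⟨hb, le_rfl⟩) hx ⟨h, mul_le_of_le_one_left hx0.le hs1⟩

theorem eventually_mem (he : IsConcaveDeviation I e) {x : ℝ} (hx : 0 < x) :
    ∀ᶠ t in 𝓝[>] (0 : ℝ), x * t ∈ I := by
  obtain ⟨b, hb, hbI⟩ := he.exists_Ioc_subset
  filter_upwards [Ioc_mem_nhdsGT (show (0 : ℝ) < b / x by positivity)] with t ht
  refine hbI ⟨mul_pos hx ht.1, ?_⟩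
  have := (le_div_iff₀ hx).1 ht.2
  linarith

theorem eventually_mem_self (he : IsConcaveDeviation I e) : ∀ᶠ t in 𝓝[>] (0 : ℝ), t ∈ I := by
  simpa using he.eventually_mem one_pos

/-- Concavity along a ray on which the deviation tends to `0` at the origin. -/
theorem mul_le_smul (he : IsConcaveDeviation I e) {x t s : ℝ} (hx : 0 < x) (ht : 0 < t)
    (hxt : x * t ∈ I) (htI : t ∈ I) (hs : 0 < s) (hs1 : s ≤ 1) :
    s * e (x * t) t ≤ e (x * (s * t)) (s * t) := by
  rcases hs1.eq_or_lt with rfl | hs1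
  · simp
  have hlim : Tendsto (fun σ : ℝ => (s - σ) / (1 - σ) * e (x * t) t +
      (1 - s) / (1 - σ) * e (x * (σ * t)) (σ * t)) (𝓝[>] 0)
      (𝓝 ((s - 0) / (1 - 0) * e (x * t) t + (1 - s) / (1 - 0) * 0)) := by
    have hid : Tendsto (fun σ : ℝ => σ) (𝓝[>] 0) (𝓝 0) := nhdsWithin_le_nhds
    have hmul : Tendsto (fun σ : ℝ => σ * t) (𝓝[>] 0) (𝓝[>] 0) := by
      refine tendsto_nhdsWithin_iff.2 ⟨?_, ?_⟩
      · simpa using hid.mul_const t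
      · filter_upwards [self_mem_nhdsWithin] with σ hσ
        exact mul_pos hσ ht
    exact (((tendsto_const_nhds.sub hid).div (tendsto_const_nhds.sub hid) (by norm_num)).mul_const
      _).add ((tendsto_const_nhds.div (tendsto_const_nhds.sub hid) (by norm_num)).mul
        ((he.tendsto_zero x hx).comp hmul))
  simp only [sub_zero, div_one, mul_zero, add_zero] at hlim
  refine le_of_tendsto hlim ?_
  filter_upwards [Ioo_mem_nhdsGT hs] with σ hσ
  have hσ1 : 0 < 1 - σ := by linarith [hσ.2]
  have h1 : x * (σ * t) ∈ I := by
    have := he.smul_mem hxt (by positivity) hσ.1 (by linarith [hσ.2])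
    rwa [show x * (σ * t) = σ * (x * t) by ring]
  have h2 : σ * t ∈ I := he.smul_mem htI ht hσ.1 (by linarith [hσ.2])
  have key := he.concaveOn.2 (show (x * t, t) ∈ I ×ˢ I from ⟨hxt, htI⟩)
    (show (x * (σ * t), σ * t) ∈ I ×ˢ I from ⟨h1, h2⟩)
    (show 0 ≤ (s - σ) / (1 - σ) from div_nonneg (by linarith [hσ.2]) hσ1.le)
    (show 0 ≤ (1 - s) / (1 - σ) from div_nonneg (by linarith) hσ1.le)
    (by field_simp; ring)
  simp only [smul_eq_mul, Prod.smul_mk, Prod.mk_add_mk] at key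
  have e1 : (s - σ) / (1 - σ) * (x * t) + (1 - s) / (1 - σ) * (x * (σ * t)) = x * (s * t) := by
    field_simp
    ring
  have e2 : (s - σ) / (1 - σ) * t + (1 - s) / (1 - σ) * (σ * t) = s * t := by
    field_simp
    ring
  rwa [e1, e2] at key

theorem quotient_antitone (he : IsConcaveDeviation I e) {x t t' : ℝ} (hx : 0 < x) (ht : 0 < t)
    (htt' : t ≤ t') (hxt : x * t' ∈ I) (htI : t' ∈ I) :
    t'⁻¹ * e (x * t') t' ≤ t⁻¹ * e (x * t) t := by
  have ht' : 0 < t' := ht.trans_le htt'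
  have := he.mul_le_smul hx ht' hxt htI (div_pos ht ht') ((div_le_one ht').2 htt')
  rw [div_mul_cancel₀ _ ht'.ne'] at this
  rw [inv_mul_le_iff₀ ht', ← mul_assoc, ← div_eq_mul_inv]
  calc e (x * t') t' = t' / t * (t / t' * e (x * t') t') := by field_simp
    _ ≤ _ := mul_le_mul_of_nonneg_left this (by positivity)

/-- The quotients increase as `t` decreases to `0`; they are nonpositive for `x ≤ 1`, and for `x >
1` they are bounded since the deviation is concave and vanishes on the diagonal. -/
theorem exists_tendsto_quotient (he : IsConcaveDeviation I e) {x : ℝ} (hx : 0 < x) :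
    ∃ l, Tendsto (fun t => t⁻¹ * e (x * t) t) (𝓝[>] 0) (𝓝 l) := by
  obtain ⟨b, hb, hbI⟩ := he.exists_Ioc_subset
  have hx1 : 0 < max x 1 := lt_max_of_lt_left hx
  set δ := b / max x 1 with hδ
  have hδ0 : 0 < δ := by positivity
  have hmem : ∀ t, 0 < t → t ≤ δ → x * t ∈ I ∧ t ∈ I := fun t ht htδ => by
    have h1 : max x 1 * t ≤ b := by
      have := (le_div_iff₀ hx1).1 htδ
      linarith
    refine ⟨hbI ⟨by positivity, le_trans ?_ h1⟩, hbI ⟨ht, le_trans ?_ h1⟩⟩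
    · exact mul_le_mul_of_nonneg_right (le_max_left _ _) ht.le
    · exact le_mul_of_one_le_left ht.le (le_max_right _ _)
  have hanti : AntitoneOn (fun t => t⁻¹ * e (x * t) t) (Ioo 0 δ) := fun t ht t' ht' htt' =>
    he.quotient_antitone hx ht.1 htt' (hmem t' ht'.1 ht'.2.le).1 (hmem t' ht'.1 ht'.2.le).2
  have hbdd : BddAbove ((fun t => t⁻¹ * e (x * t) t) '' Ioo 0 δ) := by
    rcases le_or_gt x 1 with h1 | h1
    · refine ⟨0, ?_⟩
      rintro _ ⟨t, ht, rfl⟩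
      have hm := hmem t ht.1 ht.2.le
      refine mul_nonpos_of_nonneg_of_nonpos (inv_pos.2 ht.1).le ?_
      rcases h1.eq_or_lt with rfl | h1
      · rw [one_mul, he.diag t hm.2]
      · exact (he.neg _ hm.1 _ hm.2 (by nlinarith [ht.1])).le
    · have hm' : ∀ t, 0 < t → t ≤ δ → 1 / 2 * t ∈ I := fun t ht htδ =>
        he.smul_mem (hmem t ht htδ).2 ht (by norm_num) (by norm_num)
      refine ⟨-(2 * (x - 1)) * (δ⁻¹ * e (1 / 2 * δ) δ), ?_⟩
      rintro _ ⟨t, ht, rfl⟩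
      have hm := hmem t ht.1 ht.2.le
      have hxx : 0 < 2 * x - 1 := by linarith
      have key := he.concaveOn.2 (show (1 / 2 * t, t) ∈ I ×ˢ I from ⟨hm' t ht.1 ht.2.le, hm.2⟩)
        (show (x * t, t) ∈ I ×ˢ I from hm)
        (show 0 ≤ 2 * (x - 1) / (2 * x - 1) from div_nonneg (by linarith) hxx.le)
        (show 0 ≤ 1 / (2 * x - 1) by positivity) (by field_simp; ring)
      simp only [smul_eq_mul, Prod.smul_mk, Prod.mk_add_mk] at key
      have e1 : 2 * (x - 1) / (2 * x - 1) * (1 / 2 * t) + 1 / (2 * x - 1) * (x * t) = t := by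
        field_simp
        ring
      have e2 : 2 * (x - 1) / (2 * x - 1) * t + 1 / (2 * x - 1) * t = t := by
        field_simp
        ring
      rw [e1, e2, he.diag t hm.2] at key
      have k2 : 2 * (x - 1) * e (1 / 2 * t) t + e (x * t) t ≤ 0 := by
        have := mul_le_mul_of_nonneg_left key hxx.le
        refine le_trans (le_of_eq ?_) (this.trans (le_of_eq (mul_zero _)))
        field_simp
      have k3 := he.quotient_antitone (x := 1 / 2) (by norm_num) ht.1 ht.2.le
        (hm' δ hδ0 le_rfl) (hmem δ hδ0 le_rfl).2
      have k4 := mul_le_mul_of_nonneg_left k2 (inv_pos.2 ht.1).le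
      have k5 := mul_le_mul_of_nonneg_left k3 (show 0 ≤ 2 * (x - 1) by linarith)
      simp only
      linarith
  exact ⟨_, hanti.tendsto_nhdsWithin_Ioo_right (nonempty_Ioo.2 hδ0) hbdd⟩

variable {h : ℝ → ℝ}

theorem quotient_le (he : IsConcaveDeviation I e) (hh : HasHomogenization e h) {x t : ℝ}
    (hx : 0 < x) (ht : 0 < t) (hxt : x * t ∈ I) (htI : t ∈ I) :
    t⁻¹ * e (x * t) t ≤ h x := by
  refine ge_of_tendsto (hh x hx) ?_
  filter_upwards [Ioc_mem_nhdsGT ht] with s hs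
  exact he.quotient_antitone hx hs.1 hs.2 hxt htI

theorem isConcaveKernel (he : IsConcaveDeviation I e) (hh : HasHomogenization e h) :
    IsConcaveKernel h := by
  have hconc : ConcaveOn ℝ (Ioi 0) h := by
    refine ⟨convex_Ioi 0, fun x hx y hy a b ha hb hab => ?_⟩
    have hx' : 0 < x := hx
    have hy' : 0 < y := hy
    have hz : 0 < a * x + b * y := convex_Ioi (0 : ℝ) hx hy ha hb hab
    simp only [smul_eq_mul]
    refine le_of_tendsto_of_tendsto (((hh x hx).const_mul a).add ((hh y hy).const_mul b))
      (hh _ hz) ?_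
    filter_upwards [he.eventually_mem hx', he.eventually_mem hy', he.eventually_mem_self,
      self_mem_nhdsWithin] with t h1 h2 h3 h4
    have h4' : 0 < t := h4
    have key := he.concaveOn.2 (show (x * t, t) ∈ I ×ˢ I from ⟨h1, h3⟩)
      (show (y * t, t) ∈ I ×ˢ I from ⟨h2, h3⟩) ha hb hab
    simp only [smul_eq_mul, Prod.smul_mk, Prod.mk_add_mk] at key
    rw [← add_mul, hab, one_mul, ← mul_assoc, ← mul_assoc, ← add_mul] at key
    have := mul_le_mul_of_nonneg_left key (inv_pos.2 h4').le
    linarith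
  have hone : h 1 = 0 := by
    refine tendsto_nhds_unique (hh 1 one_pos) (tendsto_const_nhds.congr' ?_)
    filter_upwards [he.eventually_mem_self] with t ht
    rw [one_mul, he.diag t ht, mul_zero]
  have hpos : ∀ x, 1 < x → 0 < h x := fun x hx => by
    obtain ⟨t, h1, h2, h3⟩ := ((he.eventually_mem (show 0 < x by linarith)).and
      (he.eventually_mem_self.and self_mem_nhdsWithin)).exists
    have h3' : 0 < t := h3
    exact (mul_pos (inv_pos.2 h3') (he.pos _ h1 _ h2 (by nlinarith))).trans_le
      (he.quotient_le hh (by linarith) h3 h1 h2)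
  refine ⟨hconc, hone, hpos, fun x hx hx1 => ?_⟩
  have h2 := hpos 2 (by norm_num)
  have key := hconc.slope_anti_adjacent hx (show (0 : ℝ) < 2 by norm_num) hx1 (by norm_num)
  rw [hone, le_div_iff₀ (by linarith)] at key
  norm_num at key
  nlinarith

/-- The deviation is dominated by its homogenization, also with the first argument increased. -/
theorem le_mul_homogenization (he : IsConcaveDeviation I e) (hh : HasHomogenization e h)
    {x y a : ℝ} (hx : x ∈ I) (hxa : x ≤ a) (ha : 0 < a) (hy : y ∈ I) (hy0 : 0 < y) :
    e x y ≤ y * h (a / y) := by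
  have hk := he.isConcaveKernel hh
  have main : ∀ x, 0 < x → x ∈ I → x ≤ a → e x y ≤ y * h (a / y) := by
    intro x hx0 hx hxa
    have e1 : x / y * y = x := div_mul_cancel₀ _ hy0.ne'
    have h1 := he.quotient_le hh (div_pos hx0 hy0) hy0 (by rwa [e1]) hy
    rw [e1, inv_mul_le_iff₀ hy0] at h1
    refine h1.trans (mul_le_mul_of_nonneg_left ?_ hy0.le)
    exact hk.monotoneOn (div_pos hx0 hy0) (div_pos ha hy0) (by gcongr)
  rcases (he.nonneg x hx).eq_or_lt with rfl | hx0
  · -- move from `0` towards `y` without passing `a`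
    set s := min (1 / 2) (a / y) with hs
    have hs0 : 0 < s := by positivity
    have hs1 : s ≤ 1 := (min_le_left _ _).trans (by norm_num)
    have hsa : s * y ≤ a := by
      have := min_le_right (1 / 2) (a / y)
      rwa [← hs, le_div_iff₀ hy0] at this
    refine le_trans ?_ (main (s * y) (by positivity) (he.smul_mem hy hy0 hs0 hs1) hsa)
    have key := he.concaveOn.2 (show ((0 : ℝ), y) ∈ I ×ˢ I from ⟨hx, hy⟩)
      (show (y, y) ∈ I ×ˢ I from ⟨hy, hy⟩) (sub_nonneg.2 hs1) hs0.le (by ring)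
    simp only [smul_eq_mul, Prod.smul_mk, Prod.mk_add_mk] at key
    rw [mul_zero, zero_add, ← add_mul, sub_add_cancel, one_mul, he.diag y hy, mul_zero,
      add_zero] at key
    nlinarith [he.neg 0 hx y hy hy0]
  · exact main x hx0 hx hxa

end IsConcaveDeviation

/-! ### The Hardy inequality and its sharpness for concave deviations -/

theorem IsHardyWeight.tendsto_const_div_cumSum {w : ℕ → ℝ} (hw : IsHardyWeight w) {a : ℝ}
    (ha : 0 < a) :
    Tendsto (fun n => a / cumSum w n) atTop (𝓝[>] 0) :=
  tendsto_nhdsWithin_iff.2 ⟨hw.tendsto.const_div_atTop a,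
    Eventually.of_forall fun n => div_pos ha (hw.cumSum_pos n)⟩

namespace IsConcaveDeviation

variable {I : Set ℝ} {e : ℝ → ℝ → ℝ} {h : ℝ → ℝ} {w : ℕ → ℝ}

/-- The finite Hardy inequality. With `S ≥ ∑ wₖ xₖ`, the arithmetic means of `x` satisfy
`Aⱼ ≤ S / Λⱼ`, so the mixed-mean inequality and the domination of `e` by its homogenization bound
the constant reached at the step `n` by a sum over the partition by the points `Λⱼ`. -/
theorem sum_le_mul_sum (he : IsConcaveDeviation I e) (hh : HasHomogenization e h)
    (hw : IsHardyWeight w) {c : ℝ} (hc : 0 < c) {x y : ℕ → ℝ}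
    (hx : ∀ n, x n ∈ I) (hy : ∀ n, y n ∈ I)
    (hxy : ∀ n, 0 ≤ ∑ j ∈ Finset.range (n + 1), w j * e (x j) (y n)) {n : ℕ} {ρ : ℝ} (hρ : 0 < ρ)
    (hρ1 : ρ < 1) (hs : GeomSummable h ρ) (hr : ∀ j ≤ n, 1 - ρ ≤ w j / cumSum w j)
    (hneg : ∀ z, c < z → geomSum h ρ z < 0) :
    ∑ k ∈ Finset.range (n + 1), w k * y k ≤ c * ∑ k ∈ Finset.range (n + 1), w k * x k := by
  have hk := he.isConcaveKernel hh
  have hA := hw.cumMean_mem he.convex hx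
  have hB := hw.cumMean_mem he.convex hy
  have hterm : ∀ k, 0 ≤ w k * x k := fun k => mul_nonneg (hw.pos k).le (he.nonneg _ (hx k))
  have main : ∀ S, 0 < S → ∑ k ∈ Finset.range (n + 1), w k * x k ≤ S →
      ∑ k ∈ Finset.range (n + 1), w k * y k ≤ c * S := by
    intro S hS hle
    rw [← hw.cumSum_mul_cumMean]
    set Y := cumMean w y n with hY
    have pn := hw.cumSum_pos n
    rcases (he.nonneg Y (hB n)).eq_or_lt with h0 | hY0
    · rw [← h0, mul_zero]
      positivity
    by_contra! hlt
    have hz : c < cumSum w n / (S / Y) := by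
      rw [div_div_eq_mul_div, lt_div_iff₀ hS]
      exact hlt
    have h1 := he.sum_cumMean_nonneg hw hx hy hxy n
    have h2 := hw.sum_perspective_le_geomSum hk hρ hρ1 hs (div_pos hS hY0) n hr
    have h3 : ∑ j ∈ Finset.range (n + 1), w j * e (cumMean w x j) Y ≤
        S * ∑ j ∈ Finset.range (n + 1), w j / cumSum w j *
          perspective h (cumSum w j / (S / Y)) := by
      rw [Finset.mul_sum]
      refine Finset.sum_le_sum fun j hj => ?_
      have pj := hw.cumSum_pos j
      have hAj : cumMean w x j ≤ S / cumSum w j := by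
        rw [le_div_iff₀ pj, mul_comm, hw.cumSum_mul_cumMean]
        refine le_trans ?_ hle
        refine Finset.sum_le_sum_of_subset_of_nonneg ?_ fun i _ _ => hterm i
        exact Finset.range_subset_range.2 (Finset.mem_range.1 hj)
      have := mul_le_mul_of_nonneg_left
        (he.le_mul_homogenization hh (hA j) hAj (div_pos hS pj) (hB n) hY0) (hw.pos j).le
      refine this.trans (le_of_eq ?_)
      have e1 : S / cumSum w j / Y = 1 / (cumSum w j / (S / Y)) := by field_simp
      rw [perspective, ← hY, e1]
      field_simp
    have h4 := hneg _ hz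
    have h5 : (1 - ρ) * geomSum h ρ (cumSum w n / (S / Y)) < 0 :=
      mul_neg_of_pos_of_neg (by linarith) h4
    have h6 : 0 ≤ S * ∑ j ∈ Finset.range (n + 1), w j / cumSum w j *
          perspective h (cumSum w j / (S / Y)) := h1.trans h3
    have h7 := nonneg_of_mul_nonneg_right h6 hS
    linarith
  refine le_of_forall_pos_le_add fun ε hε => ?_
  have hd : 0 < ε / c := div_pos hε hc
  have := main (∑ k ∈ Finset.range (n + 1), w k * x k + ε / c)
    (add_pos_of_nonneg_of_pos (Finset.sum_nonneg fun k _ => hterm k) hd) (by linarith)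
  rwa [mul_add, mul_div_cancel₀ _ hc.ne'] at this

/-- The test sequence `xₙ = ε / Λₙ`. At `t = c ε / Λₙ` one has `xⱼ = v t` with `v = Λₙ / (c Λⱼ)`.
The indices with `Λⱼ ≤ ρᴷ Λₙ` contribute nonnegative terms. The others are grouped by the powers
of `ρ`: on each group concavity bounds `e(xⱼ, t)` below by its values at the two ends, which
reduces the claim to the limits of finitely many quotients `e(v t, t) / t`. -/
theorem eventually_test_nonneg (he : IsConcaveDeviation I e) (hh : HasHomogenization e h)
    (hw : IsHardyWeight w) {ρ : ℝ} (hρ : 0 < ρ) (hρ1 : ρ < 1) (hmass : HasGeometricMass w ρ)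
    {c ε : ℝ} (hc : 0 < c) (hε : 0 < ε) (hεI : ∀ n, ε / cumSum w n ∈ I) {K : ℕ}
    (hcK : c * ρ ^ K ≤ 1)
    (hpos : 0 < ∑ k ∈ Finset.range K, perspective h (c * ρ ^ k)) :
    ∀ᶠ n in atTop, c * ε / cumSum w n ∈ I ∧
      0 ≤ ∑ j ∈ Finset.range (n + 1), w j * e (ε / cumSum w j) (c * ε / cumSum w n) := by
  have hk := he.isConcaveKernel hh
  set t : ℕ → ℝ := fun n => c * ε / cumSum w n with ht
  have htt : Tendsto t atTop (𝓝[>] 0) := hw.tendsto_const_div_cumSum (by positivity)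
  have ht0 : ∀ n, 0 < t n := fun n => div_pos (by positivity) (hw.cumSum_pos n)
  set v : ℕ → ℝ := fun k => 1 / (c * ρ ^ k) with hv
  have hv0 : ∀ k, 0 < v k := fun k => by positivity
  set a : ℕ → ℕ → ℝ := fun k n => (t n)⁻¹ * e (v k * t n) (t n) with ha
  have hatend : ∀ k, Tendsto (a k) atTop (𝓝 (h (v k))) := fun k => (hh _ (hv0 k)).comp htt
  set b : ℕ → ℕ → ℝ := fun k n => min (a k n) (a (k + 1) n) with hb
  have hbtend : ∀ k, Tendsto (b k) atTop (𝓝 (h (v k))) := fun k => by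
    have hle : h (v k) ≤ h (v (k + 1)) := hk.monotoneOn (hv0 k) (hv0 (k + 1))
      (one_div_le_one_div_of_le (by positivity)
        (mul_le_mul_of_nonneg_left (pow_le_pow_of_le_one hρ.le hρ1.le k.le_succ) hc.le))
    have := (hatend k).min (hatend (k + 1))
    rwa [min_eq_left hle] at this
  set m : ℕ → ℕ → ℝ := fun k n => massBelow w n (ρ ^ k * cumSum w n) with hm
  have hlim : Tendsto (fun n => ∑ k ∈ Finset.range K,
      b k n * (m k n / cumSum w n - m (k + 1) n / cumSum w n)) atTop
      (𝓝 (∑ k ∈ Finset.range K, h (v k) * (ρ ^ k - ρ ^ (k + 1)))) :=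
    tendsto_finsetSum _ fun k _ => (hbtend k).mul ((hmass k).sub (hmass (k + 1)))
  have hlimpos : 0 < ∑ k ∈ Finset.range K, h (v k) * (ρ ^ k - ρ ^ (k + 1)) := by
    have e1 : ∑ k ∈ Finset.range K, h (v k) * (ρ ^ k - ρ ^ (k + 1)) =
        (1 - ρ) / c * ∑ k ∈ Finset.range K, perspective h (c * ρ ^ k) := by
      rw [Finset.mul_sum]
      refine Finset.sum_congr rfl fun k _ => ?_
      simp only [hv, perspective, pow_succ]
      field_simp
    rw [e1]
    have : 0 < 1 - ρ := by linarith
    positivity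
  have hmem : ∀ᶠ n in atTop, ∀ k ∈ Finset.range (K + 1), v k * t n ∈ I :=
    (Finset.eventually_all _).2 fun k _ => htt.eventually (he.eventually_mem (hv0 k))
  filter_upwards [hlim.eventually (lt_mem_nhds hlimpos), hmem,
    htt.eventually he.eventually_mem_self] with n hn hvI htI
  refine ⟨htI, ?_⟩
  have pn := hw.cumSum_pos n
  set g : ℕ → ℕ → ℝ := fun j k => if cumSum w j ≤ ρ ^ k * cumSum w n then w j else 0 with hg
  have hm' : ∀ k, m k n = ∑ j ∈ Finset.range (n + 1), g j k := fun k => Finset.sum_filter _ _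
  have hterm : ∀ j ∈ Finset.range (n + 1),
      ∑ k ∈ Finset.range K, b k n * (g j k - g j (k + 1)) ≤
        (t n)⁻¹ * (w j * e (ε / cumSum w j) (t n)) := by
    intro j hj
    have pj := hw.cumSum_pos j
    have hjn : cumSum w j ≤ cumSum w n :=
      hw.strictMono_cumSum.monotone (Finset.mem_range_succ_iff.1 hj)
    have hanti : ∀ k l, k ≤ l → ρ ^ l * cumSum w n ≤ ρ ^ k * cumSum w n := fun k l hkl =>
      mul_le_mul_of_nonneg_right (pow_le_pow_of_le_one hρ.le hρ1.le hkl) pn.le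
    by_cases hjK : cumSum w j ≤ ρ ^ K * cumSum w n
    · have hz : ∑ k ∈ Finset.range K, b k n * (g j k - g j (k + 1)) = 0 := by
        refine Finset.sum_eq_zero fun k hkK => ?_
        have hkK' := Finset.mem_range.1 hkK
        simp only [hg]
        rw [if_pos (hjK.trans (hanti _ _ hkK'.le)), if_pos (hjK.trans (hanti _ _ hkK')),
          sub_self, mul_zero]
      rw [hz]
      refine mul_nonneg (inv_pos.2 (ht0 n)).le (mul_nonneg (hw.pos j).le ?_)
      have hle : t n ≤ ε / cumSum w j := by
        simp only [ht]
        rw [div_le_div_iff₀ pn pj]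
        have : c * cumSum w j ≤ cumSum w n := by
          calc c * cumSum w j ≤ c * (ρ ^ K * cumSum w n) := by gcongr
            _ = c * ρ ^ K * cumSum w n := by ring
            _ ≤ _ := mul_le_of_le_one_left pn.le hcK
        nlinarith
      rcases hle.eq_or_lt with h' | h'
      · rw [← h', he.diag _ htI]
      · exact (he.pos _ (hεI j) _ htI h').le
    · obtain ⟨i, hi1, hi2⟩ := exists_nat_pow_near_of_lt_one (x := cumSum w j / cumSum w n) (y := ρ)
        (div_pos pj pn) ((div_le_one pn).2 hjn) hρ hρ1
      rw [lt_div_iff₀ pn] at hi1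
      rw [div_le_iff₀ pn] at hi2
      have hiK : i < K := by
        by_contra! hKi
        exact hjK (hi2.trans (hanti _ _ hKi))
      have hz : ∑ k ∈ Finset.range K, b k n * (g j k - g j (k + 1)) = b i n * w j := by
        rw [Finset.sum_eq_single i]
        · simp only [hg]
          rw [if_pos hi2, if_neg (not_le.2 hi1), sub_zero]
        · intro k _ hki
          simp only [hg]
          rcases lt_or_gt_of_ne hki with hlt | hgt
          · rw [if_pos (hi2.trans (hanti _ _ hlt.le)), if_pos (hi2.trans (hanti _ _ hlt)),
              sub_self, mul_zero]
          · rw [if_neg (not_le.2 ((hanti _ _ hgt).trans_lt hi1)),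
              if_neg (not_le.2 ((hanti _ _ (by omega)).trans_lt hi1)), sub_self, mul_zero]
        · intro hnot
          exact absurd (Finset.mem_range.2 hiK) hnot
      rw [hz]
      have hcx : ConcaveOn ℝ I fun x => e x (t n) := by
        refine ⟨he.convex, fun x hx y hy α β hα hβ hαβ => ?_⟩
        have := he.concaveOn.2 (show (x, t n) ∈ I ×ˢ I from ⟨hx, htI⟩)
          (show (y, t n) ∈ I ×ˢ I from ⟨hy, htI⟩) hα hβ hαβ
        simpa [← add_mul, hαβ] using this
      have hvt : ∀ k, v k * t n = ε / (ρ ^ k * cumSum w n) := fun k => by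
        simp only [hv, ht]
        field_simp
      have hmin := hcx.min_le_of_mem_Icc (z := ε / cumSum w j)
        (hvI i (Finset.mem_range.2 (by omega))) (hvI (i + 1) (Finset.mem_range.2 (by omega)))
        ⟨by
          rw [hvt]
          exact div_le_div_of_nonneg_left hε.le pj hi2, by
          rw [hvt]
          exact div_le_div_of_nonneg_left hε.le (by positivity) hi1.le⟩
      have hbi : b i n ≤ (t n)⁻¹ * e (ε / cumSum w j) (t n) := by
        have h1 := mul_le_mul_of_nonneg_left hmin (inv_pos.2 (ht0 n)).le
        rwa [mul_min_of_nonneg _ _ (inv_pos.2 (ht0 n)).le] at h1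
      have := mul_le_mul_of_nonneg_right hbi (hw.pos j).le
      linarith
  have hsum := Finset.sum_le_sum hterm
  rw [Finset.sum_comm, ← Finset.mul_sum] at hsum
  have hswap : ∑ k ∈ Finset.range K, ∑ j ∈ Finset.range (n + 1), b k n * (g j k - g j (k + 1)) =
      cumSum w n * ∑ k ∈ Finset.range K,
        b k n * (m k n / cumSum w n - m (k + 1) n / cumSum w n) := by
    rw [Finset.mul_sum]
    refine Finset.sum_congr rfl fun k _ => ?_
    rw [← Finset.mul_sum, Finset.sum_sub_distrib, ← hm', ← hm']
    field_simp
  rw [hswap] at hsum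
  have h1 := (mul_pos pn hn).trans_le hsum
  exact (pos_of_mul_pos_right h1 (inv_pos.2 (ht0 n)).le).le

end IsConcaveDeviation

/-! ### Normalized quasideviations and their means -/

section Quasideviation

variable {I : Set ℝ} {E : ℝ → ℝ → ℝ}

theorem IsNormalizableQuasideviation.isConcaveDeviation (hE : IsNormalizableQuasideviation I E)
    (hI : I.OrdConnected) (hInt : I.Nontrivial) (hI0 : IsGLB I 0)
    (hconc : ConcaveOn ℝ (I ×ˢ I) (fun p : ℝ × ℝ => normalization I E p.1 p.2))
    (hzero : ∀ x : ℝ, 0 < x →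
      Tendsto (fun t => normalization I E (x * t) t) (𝓝[>] 0) (𝓝 0)) :
    IsConcaveDeviation I (normalization I E) where
  convex := hI.convex
  nonneg x hx := hI0.1 hx
  exists_Ioc_subset := by
    obtain ⟨b, hb, hb0⟩ := hInt.exists_ne 0
    have hbpos : 0 < b := lt_of_le_of_ne (hI0.1 hb) hb0.symm
    refine ⟨b, hbpos, fun x hx => ?_⟩
    obtain ⟨y, hy, -, hyx⟩ := hI0.exists_between hx.1
    exact hI.out hy hb ⟨hyx.le, hx.2⟩
  concaveOn := hconc
  pos x hx y hy hyx := by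
    have h1 := hE.sign_eq x hx y hy
    rw [sign_pos (by linarith : 0 < x - y), sign_eq_one_iff] at h1
    exact div_pos h1 (by linarith [hE.diagDeriv_neg y hy])
  neg x hx y hy hxy := by
    have h1 := hE.sign_eq x hx y hy
    rw [sign_neg (by linarith : x - y < 0), sign_eq_neg_one_iff] at h1
    exact div_neg_of_neg_of_pos h1 (by linarith [hE.diagDeriv_neg y hy])
  diag x hx := by
    have h1 := hE.sign_eq x hx x hx
    rw [sub_self, sign_zero, sign_eq_zero_iff] at h1
    rw [normalization, h1, zero_div]
  tendsto_zero := hzero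

variable {n : ℕ} {x w : Fin n → ℝ}

theorem IsQuasideviation.quasideviationMean_spec (hE : IsQuasideviation I E)
    (hI : I.OrdConnected) (hx : ∀ i, x i ∈ I) (hw : ∀ i, 0 ≤ w i) (hpos : 0 < ∑ i, w i) :
    quasideviationMean I E n x w ∈ I ∧ ∑ i, w i * E (x i) (quasideviationMean I E n x w) = 0 := by
  have h : ∃ y ∈ I, ∑ i, w i * E (x i) y = 0 :=
    (existsUnique_quasideviationMean hE x w hx hw hpos).exists
  rw [quasideviationMean, dif_pos h]
  exact h.choose_spec

/-- A point where the defining sum is nonnegative lies below the mean: otherwise the sum would have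
a second zero between that point and the largest of the entries. -/
theorem IsQuasideviation.le_quasideviationMean (hE : IsQuasideviation I E)
    (hI : I.OrdConnected) (hx : ∀ i, x i ∈ I) (hw : ∀ i, 0 ≤ w i) (hpos : 0 < ∑ i, w i)
    {z : ℝ} (hz : z ∈ I) (hsum : 0 ≤ ∑ i, w i * E (x i) z) :
    z ≤ quasideviationMean I E n x w := by
  obtain ⟨hy, hy0⟩ := hE.quasideviationMean_spec hI hx hw hpos
  set y := quasideviationMean I E n x w
  have huniq : ∀ u, u ∈ I ∧ ∑ i, w i * E (x i) u = 0 → y = u := fun u hu =>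
    (existsUnique_quasideviationMean hE x w hx hw hpos).unique ⟨hy, hy0⟩ hu
  by_contra! hlt
  have hne : Nonempty (Fin n) := by
    by_contra hc
    rw [not_nonempty_iff] at hc
    simp at hpos
  obtain ⟨i₁, h₁⟩ := Finite.exists_max x
  -- the sum is nonpositive at any upper bound of the entries
  have hup : ∀ u ∈ I, x i₁ ≤ u → ∑ i, w i * E (x i) u ≤ 0 := fun u hu hle =>
    Finset.sum_nonpos fun i _ => by
      refine mul_nonpos_of_nonneg_of_nonpos (hw i) ?_
      have := hE.sign_eq _ (hx i) _ hu
      rw [← sign_nonpos_iff, this, sign_nonpos_iff]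
      linarith [h₁ i]
  rcases le_total (x i₁) z with h | h
  · have h0 := le_antisymm (hup z hz h) hsum
    exact hlt.ne (huniq _ ⟨hz, h0⟩)
  · have hsub : Icc z (x i₁) ⊆ I := hI.out hz (hx i₁)
    have hcont : ContinuousOn (fun y => ∑ i, w i * E (x i) y) (Icc z (x i₁)) :=
      continuousOn_finsetSum _ fun i _ =>
        continuousOn_const.mul ((hE.continuousOn _ (hx i)).mono hsub)
    obtain ⟨u, hu, hu0⟩ := intermediate_value_Icc' h hcont ⟨hup _ (hx i₁) le_rfl, hsum⟩
    exact (hlt.trans_le hu.1).ne (huniq _ ⟨hsub hu, hu0⟩)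

theorem sum_fin_normalization (w x : ℕ → ℝ) (n : ℕ) (y : ℝ) :
    ∑ j ∈ Finset.range (n + 1), w j * normalization I E (x j) y =
      (∑ i : Fin (n + 1), w i * E (x i) y) / (-diagDeriv I E y) := by
  rw [Fin.sum_univ_eq_sum_range (fun j => w j * E (x j) y), Finset.sum_div]
  exact Finset.sum_congr rfl fun j _ => by rw [normalization, mul_div_assoc]

end Quasideviation

/-! ### Bounds for the Hardy constant -/

section HardyConstant

variable {I : Set ℝ} {E : ℝ → ℝ → ℝ} {h : ℝ → ℝ} {w : ℕ → ℝ}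

theorem hardyConstant_le (hE : IsNormalizableQuasideviation I E) (hI : I.OrdConnected)
    (he : IsConcaveDeviation I (normalization I E)) (hh : HasHomogenization (normalization I E) h)
    (hw : IsHardyWeight w) {c : ℝ} (hc : 0 < c)
    (hcrit : ∀ n, ∃ ρ, 0 < ρ ∧ ρ < 1 ∧ GeomSummable h ρ ∧ (∀ j ≤ n, 1 - ρ ≤ w j / cumSum w j) ∧
      ∀ z, c < z → geomSum h ρ z < 0) :
    hardyConstant I (quasideviationMean I E) w ≤ ENNReal.ofReal c := by
  refine sInf_le fun x hx => ?_
  set y : ℕ → ℝ := fun n => quasideviationMean I E (n + 1) (fun i => x i) (fun i => w i) with hy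
  have hspec : ∀ n, y n ∈ I ∧ ∑ i : Fin (n + 1), w i * E (x i) (y n) = 0 := fun n =>
    hE.quasideviationMean_spec hI (fun i => hx i) (fun i => (hw.pos i).le)
      (Finset.sum_pos (fun i _ => hw.pos i) Finset.univ_nonempty)
  refine ENNReal.tsum_le_of_sum_range_le fun m => ?_
  rcases m with _ | n
  · simp
  obtain ⟨ρ, h0, h1, hs, hr, hneg⟩ := hcrit n
  have key := he.sum_le_mul_sum hh hw hc hx (fun n => (hspec n).1)
    (fun n => by rw [sum_fin_normalization, (hspec n).2, zero_div]) h0 h1 hs hr hneg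
  have hy0 : ∀ k, 0 ≤ w k * y k := fun k =>
    mul_nonneg (hw.pos k).le (he.nonneg _ (hspec k).1)
  have hx0 : ∀ k, 0 ≤ w k * x k := fun k => mul_nonneg (hw.pos k).le (he.nonneg _ (hx k))
  calc ∑ k ∈ Finset.range (n + 1), ENNReal.ofReal (w k * y k)
      = ENNReal.ofReal (∑ k ∈ Finset.range (n + 1), w k * y k) :=
        (ENNReal.ofReal_sum_of_nonneg fun k _ => hy0 k).symm
    _ ≤ ENNReal.ofReal (c * ∑ k ∈ Finset.range (n + 1), w k * x k) := ENNReal.ofReal_le_ofReal key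
    _ = ENNReal.ofReal c * ∑ k ∈ Finset.range (n + 1), ENNReal.ofReal (w k * x k) := by
        rw [ENNReal.ofReal_mul hc.le, ENNReal.ofReal_sum_of_nonneg fun k _ => hx0 k]
    _ ≤ _ := by
        gcongr
        exact ENNReal.sum_le_tsum _

/-- The test sequence is `ε / Λₙ` for `n ≤ N`, continued by terms of bounded total weight. Since
`∑ wₙ / Λₙ` diverges, the bounded error terms are negligible as `N → ∞`. -/
theorem le_hardyConstant (hE : IsNormalizableQuasideviation I E) (hI : I.OrdConnected)
    (he : IsConcaveDeviation I (normalization I E)) (hh : HasHomogenization (normalization I E) h)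
    (hw : IsHardyWeight w) {ρ : ℝ} (hρ : 0 < ρ) (hρ1 : ρ < 1) (hmass : HasGeometricMass w ρ)
    {c : ℝ} (hc : 0 < c) {K : ℕ} (hcK : c * ρ ^ K ≤ 1)
    (hpos : 0 < ∑ k ∈ Finset.range K, perspective h (c * ρ ^ k)) :
    ENNReal.ofReal c ≤ hardyConstant I (quasideviationMean I E) w := by
  obtain ⟨b, hb, hbI⟩ := he.exists_Ioc_subset
  set ε := b * cumSum w 0 with hεdef
  have hε : 0 < ε := mul_pos hb (hw.cumSum_pos 0)
  have hεI : ∀ n, ε / cumSum w n ∈ I := fun n => by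
    refine hbI ⟨div_pos hε (hw.cumSum_pos n), ?_⟩
    rw [div_le_iff₀ (hw.cumSum_pos n)]
    exact mul_le_mul_of_nonneg_left (hw.strictMono_cumSum.monotone n.zero_le) hb.le
  obtain ⟨n₀, hn₀⟩ := eventually_atTop.1
    (he.eventually_test_nonneg hh hw hρ hρ1 hmass hc hε hεI hcK hpos)
  refine le_sInf fun C hC => ?_
  rcases eq_or_ne C ⊤ with rfl | hCtop
  · exact le_top
  rw [ENNReal.ofReal_le_iff_le_toReal hCtop]
  set γ := C.toReal with hγ
  have hγ0 : 0 ≤ γ := ENNReal.toReal_nonneg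
  set D : ℕ → ℝ := fun n => ∑ j ∈ Finset.range (n + 1), w j / cumSum w j with hD
  have hr0 : ∀ j, 0 < w j / cumSum w j := fun j => div_pos (hw.pos j) (hw.cumSum_pos j)
  have hDpos : ∀ n, 0 ≤ D n := fun n => Finset.sum_nonneg fun j _ => (hr0 j).le
  have main : ∀ N, n₀ ≤ N → c * ε * (D N - D n₀) ≤ γ * (ε * D N + 2) := by
    intro N hN
    set x : ℕ → ℝ := fun n => if n ≤ N then ε / cumSum w n else min b ((1 / 2) ^ n / w n) with hx
    have hxI : ∀ n, x n ∈ I := fun n => by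
      simp only [hx]
      split_ifs
      · exact hεI n
      · have := hw.pos n
        exact hbI ⟨lt_min hb (by positivity), min_le_left _ _⟩
    have hx0 : ∀ n, 0 ≤ w n * x n := fun n => mul_nonneg (hw.pos n).le (he.nonneg _ (hxI n))
    have hright : ∑' n, ENNReal.ofReal (w n * x n) ≤ ENNReal.ofReal (ε * D N + 2) := by
      refine ENNReal.tsum_le_of_sum_range_le fun m => ?_
      rw [← ENNReal.ofReal_sum_of_nonneg fun k _ => hx0 k]
      refine ENNReal.ofReal_le_ofReal ?_
      have h1 : ∀ k ∈ Finset.range m, w k * x k ≤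
          (if k ≤ N then ε * (w k / cumSum w k) else 0) + (1 / 2) ^ k := fun k _ => by
        have hk : (0 : ℝ) < (1 / 2) ^ k := by positivity
        simp only [hx]
        split_ifs
        · have : w k * (ε / cumSum w k) = ε * (w k / cumSum w k) := by ring
          linarith
        · rw [zero_add]
          calc w k * min b ((1 / 2) ^ k / w k) ≤ w k * ((1 / 2) ^ k / w k) :=
                mul_le_mul_of_nonneg_left (min_le_right _ _) (hw.pos k).le
            _ = (1 / 2) ^ k := mul_div_cancel₀ _ (hw.pos k).ne'
      refine (Finset.sum_le_sum h1).trans ?_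
      rw [Finset.sum_add_distrib]
      refine add_le_add ?_ (sum_geometric_two_le m)
      rw [← Finset.sum_filter, ← Finset.mul_sum]
      refine mul_le_mul_of_nonneg_left ?_ hε.le
      refine Finset.sum_le_sum_of_subset_of_nonneg (fun k hk => ?_) fun k _ _ => (hr0 k).le
      exact Finset.mem_range_succ_iff.2 (Finset.mem_filter.1 hk).2
    set y : ℕ → ℝ := fun n => quasideviationMean I E (n + 1) (fun i => x i) (fun i => w i) with hy
    have hwpos : ∀ n, 0 < ∑ i : Fin (n + 1), w i := fun n =>
      Finset.sum_pos (fun i _ => hw.pos i) Finset.univ_nonempty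
    have hy0 : ∀ n, 0 ≤ w n * y n := fun n => mul_nonneg (hw.pos n).le
      (he.nonneg _ (hE.quasideviationMean_spec hI (fun i => hxI i) (fun i => (hw.pos i).le)
        (hwpos n)).1)
    have hylow : ∀ n, n₀ ≤ n → n ≤ N → c * ε / cumSum w n ≤ y n := fun n h1 h2 => by
      obtain ⟨h3, h4⟩ := hn₀ n h1
      refine hE.le_quasideviationMean hI (fun i => hxI i) (fun i => (hw.pos i).le) (hwpos n) h3 ?_
      rw [sum_fin_normalization w (fun j => ε / cumSum w j)] at h4
      have h5 : 0 < -diagDeriv I E (c * ε / cumSum w n) := by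
        linarith [hE.diagDeriv_neg _ h3]
      have h6 := (le_div_iff₀ h5).1 h4
      rw [zero_mul] at h6
      refine h6.trans (le_of_eq (Finset.sum_congr rfl fun i _ => ?_))
      simp only [hx]
      rw [if_pos (by omega)]
    have hleft : c * ε * (D N - D n₀) ≤ ∑ k ∈ Finset.range (N + 1), w k * y k := by
      have e1 : D N - D n₀ = ∑ k ∈ Finset.Ico (n₀ + 1) (N + 1), w k / cumSum w k :=
        (Finset.sum_Ico_eq_sub _ (by omega)).symm
      rw [e1, Finset.mul_sum]
      refine (Finset.sum_le_sum fun k hk => ?_ : _ ≤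
        ∑ k ∈ Finset.Ico (n₀ + 1) (N + 1), w k * y k).trans
        (Finset.sum_le_sum_of_subset_of_nonneg (fun k hk => ?_) fun k _ _ => hy0 k)
      · have hk' := Finset.mem_Ico.1 hk
        have := mul_le_mul_of_nonneg_left (hylow k (by omega) (by omega)) (hw.pos k).le
        refine le_trans (le_of_eq ?_) this
        ring
      · exact Finset.mem_range.2 (Finset.mem_Ico.1 hk).2
    have hin := hC x hxI
    have hfin : ENNReal.ofReal (∑ k ∈ Finset.range (N + 1), w k * y k) ≤
        ENNReal.ofReal (γ * (ε * D N + 2)) := by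
      rw [ENNReal.ofReal_sum_of_nonneg fun k _ => hy0 k, ENNReal.ofReal_mul hγ0, hγ,
        ENNReal.ofReal_toReal hCtop]
      refine (ENNReal.sum_le_tsum _).trans (hin.trans ?_)
      gcongr
    have hnn : 0 ≤ γ * (ε * D N + 2) := by
      have := hDpos N
      positivity
    exact hleft.trans ((ENNReal.ofReal_le_ofReal_iff hnn).1 hfin)
  by_contra! hlt
  have hD' : Tendsto D atTop atTop := hw.tendsto_cumSum_ratio
  have hd : 0 < (c - γ) * ε := mul_pos (by linarith) hε
  obtain ⟨N, hN1, hN2⟩ := ((hD'.const_mul_atTop hd).eventually_gt_atTop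
    (c * ε * D n₀ + 2 * γ)).and (eventually_ge_atTop n₀) |>.exists
  have := main N hN2
  nlinarith

end HardyConstant

/-! ### The critical constant -/

section CriticalConstant

variable {I : Set ℝ} {E : ℝ → ℝ → ℝ} {h : ℝ → ℝ} {w : ℕ → ℝ} {η : ℝ}

theorem IsHardyWeight.exists_hasGeometricMass (hw : IsHardyWeight w) (hη : η ∈ Ico (0 : ℝ) 1)
    (hlim : Tendsto (fun n => w n / cumSum w n) atTop (𝓝 η)) :
    ∃ ρ, 0 < ρ ∧ ρ < 1 ∧ HasGeometricMass w ρ := by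
  rcases hη.1.eq_or_lt with rfl | h0
  · exact ⟨1 / 2, by norm_num, by norm_num,
      hw.hasGeometricMass_of_tendsto_zero hlim (by norm_num) (by norm_num)⟩
  · exact ⟨1 - η, by linarith [hη.2], by linarith,
      hw.hasGeometricMass_of_tendsto_pos h0 hη.2 hlim⟩

theorem IsConcaveDeviation.hasHomogenization
    (he : IsConcaveDeviation I (normalization I E)) :
    HasHomogenization (normalization I E) (homogenizedDeviation I E) :=
  fun _ hx => tendsto_nhds_limUnder (he.exists_tendsto_quotient hx)

/-- For a constant beyond the Hardy constant no truncated geometric sum can be positive, which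
bounds the partial sums of a series with eventually nonnegative terms. -/
theorem integrableOn_of_isHardyMean (hE : IsNormalizableQuasideviation I E) (hI : I.OrdConnected)
    (he : IsConcaveDeviation I (normalization I E)) (hh : HasHomogenization (normalization I E) h)
    (hw : IsHardyWeight w) (hη : η ∈ Ico (0 : ℝ) 1)
    (hlim : Tendsto (fun n => w n / cumSum w n) atTop (𝓝 η))
    (hH : IsHardyMean I (quasideviationMean I E) w) (b : ℝ) :
    IntegrableOn (fun y => h (1 / y)) (Ioc 0 b) := by
  have hk := he.isConcaveKernel hh
  obtain ⟨ρ, hρ, hρ1, hmass⟩ := hw.exists_hasGeometricMass hη hlim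
  set C := hardyConstant I (quasideviationMean I E) w with hC
  have hCtop : C ≠ ⊤ := ne_of_lt hH
  have hz : 0 < C.toReal + 1 := by
    have : 0 ≤ C.toReal := ENNReal.toReal_nonneg
    linarith
  have hs := hk.summable_of_partial_nonpos hρ hρ1 hz fun K hK => by
    by_contra! hpos
    have := le_hardyConstant hE hI he hh hw hρ hρ1 hmass hz hK hpos
    rw [← hC, ENNReal.ofReal_le_iff_le_toReal hCtop] at this
    linarith
  exact hk.antitoneOn_inv.integrableOn_Ioc_zero hz
    (hk.integrableOn_of_summable hρ hρ1 hz hs) b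

theorem hardyConstant_eq (hE : IsNormalizableQuasideviation I E) (hI : I.OrdConnected)
    (he : IsConcaveDeviation I (normalization I E)) (hh : HasHomogenization (normalization I E) h)
    (hw : IsHardyWeight w) {c : ℝ} (hc : 0 < c)
    (hup : ∀ n, ∃ ρ, 0 < ρ ∧ ρ < 1 ∧ GeomSummable h ρ ∧ (∀ j ≤ n, 1 - ρ ≤ w j / cumSum w j) ∧
      ∀ z, c < z → geomSum h ρ z < 0)
    (hlow : ∀ z, 0 < z → z < c → ∃ ρ, 0 < ρ ∧ ρ < 1 ∧ GeomSummable h ρ ∧ HasGeometricMass w ρ ∧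
      0 < geomSum h ρ z) :
    hardyConstant I (quasideviationMean I E) w = ENNReal.ofReal c := by
  refine le_antisymm (hardyConstant_le hE hI he hh hw hc hup) ?_
  by_contra! hlt
  set C := hardyConstant I (quasideviationMean I E) w with hC
  have hCtop : C ≠ ⊤ := hlt.ne_top
  have hC0 : 0 ≤ C.toReal := ENNReal.toReal_nonneg
  have hlt' : C.toReal < c := (ENNReal.lt_ofReal_iff_toReal_lt hCtop).1 hlt
  obtain ⟨ρ, hρ, hρ1, hs, hmass, hpos⟩ := hlow ((C.toReal + c) / 2) (by linarith) (by linarith)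
  obtain ⟨K, hK, hKpos⟩ := exists_partial_geomSum_pos hρ hρ1 hs (by linarith) hpos
  have := le_hardyConstant hE hI he hh hw hρ hρ1 hmass (by linarith) hK hKpos
  rw [← hC, ENNReal.ofReal_le_iff_le_toReal hCtop] at this
  linarith

/-- When the ratios `wₙ / Λₙ` tend to `0`, the critical constant is the zero of
`z ↦ ∫₀ᶻ h(1/y) dy`. -/
theorem exists_hardyConstant_eq_of_zero (hE : IsNormalizableQuasideviation I E)
    (hI : I.OrdConnected) (he : IsConcaveDeviation I (normalization I E))
    (hh : HasHomogenization (normalization I E) h) (hw : IsHardyWeight w)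
    (hlim : Tendsto (fun n => w n / cumSum w n) atTop (𝓝 0))
    (hi : ∀ b, IntegrableOn (fun y => h (1 / y)) (Ioc 0 b)) :
    ∃ c : ℝ, hardyConstant I (quasideviationMean I E) w = ENNReal.ofReal c ∧
      SolvesHardyEquation h 0 c ∧ ∀ c', SolvesHardyEquation h 0 c' → c' = c := by
  have hk := he.isConcaveKernel hh
  obtain ⟨c, hc1, hc0, hneg, hpos⟩ :=
    (hk.antitoneOn_inv.concaveOn_setIntegral hi).exists_sign_change
      (fun z h0 h1 => hk.setIntegral_pos hi h0 h1) (hk.exists_setIntegral_neg hi)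
  have hc : 0 < c := by linarith
  refine ⟨c, hardyConstant_eq hE hI he hh hw hc (fun n => ?_) (fun z hz hzc => ?_),
    ⟨hc, fun _ => ⟨integrableOn_inv_mul hc (hi c), ?_⟩, fun h => (lt_irrefl _ h).elim⟩, ?_⟩
  · -- the ratios do not increase, so `wₙ / Λₙ` is a lower bound for those with `j ≤ n`
    have hr : 0 < w n / cumSum w n := div_pos (hw.pos n) (hw.cumSum_pos n)
    have hm : 0 < min (w n / cumSum w n) (1 / 2) := lt_min hr (by norm_num)
    have hm2 : min (w n / cumSum w n) (1 / 2) ≤ 1 / 2 := min_le_right _ _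
    have h0 : 0 < 1 - min (w n / cumSum w n) (1 / 2) := by linarith
    have h1 : 1 - min (w n / cumSum w n) (1 / 2) < 1 := by linarith
    refine ⟨1 - min (w n / cumSum w n) (1 / 2), h0, h1, hk.geomSummable_of_integrableOn h0 h1 hi,
      fun j hj => ?_, fun z hz => ?_⟩
    · rw [sub_sub_cancel]
      exact (min_le_left _ _).trans (hw.antitone hj)
    · have h2 := hk.mul_geomSum_le_setIntegral h0 h1 (hc.trans hz) hi
      rw [sub_sub_cancel] at h2
      exact neg_of_mul_neg_right (h2.trans_lt (hneg z hz)) hm.le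
  · obtain ⟨ρ, h0, h1, h2⟩ := hk.exists_geomSum_pos_of_setIntegral_pos hz hi (hpos z hz hzc)
    exact ⟨ρ, h0, h1, hk.geomSummable_of_integrableOn h0 h1 hi,
      hw.hasGeometricMass_of_tendsto_zero hlim h0 h1, h2⟩
  · rw [setIntegral_inv_mul h hc, hc0, mul_zero]
  · rintro c' ⟨hc', hsol, -⟩
    have h1 := (hsol rfl).2
    rw [setIntegral_inv_mul h hc', mul_eq_zero] at h1
    have h2 := h1.resolve_left (inv_pos.2 hc').ne'
    rcases lt_trichotomy c' c with h3 | h3 | h3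
    · exact absurd h2 (hpos c' hc' h3).ne'
    · exact h3
    · exact absurd h2 (hneg c' h3).ne

/-- When the ratios `wₙ / Λₙ` tend to `η > 0`, the critical constant is the zero of the geometric
sum with ratio `1 - η`. -/
theorem exists_hardyConstant_eq_of_pos (hE : IsNormalizableQuasideviation I E)
    (hI : I.OrdConnected) (he : IsConcaveDeviation I (normalization I E))
    (hh : HasHomogenization (normalization I E) h) (hw : IsHardyWeight w) (hη : 0 < η)
    (hη1 : η < 1) (hlim : Tendsto (fun n => w n / cumSum w n) atTop (𝓝 η))
    (hi : ∀ b, IntegrableOn (fun y => h (1 / y)) (Ioc 0 b)) :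
    ∃ c : ℝ, hardyConstant I (quasideviationMean I E) w = ENNReal.ofReal c ∧
      SolvesHardyEquation h η c ∧ ∀ c', SolvesHardyEquation h η c' → c' = c := by
  have hk := he.isConcaveKernel hh
  have h0 : 0 < 1 - η := by linarith
  have h1 : 1 - η < 1 := by linarith
  have hs := hk.geomSummable_of_integrableOn h0 h1 hi
  obtain ⟨c, hc1, hc0, hneg, hpos⟩ := (hk.concaveOn_geomSum h0 hs).exists_sign_change
    (fun z hz hz1 => hk.geomSum_pos h0 h1 hs hz hz1) (hk.exists_geomSum_neg h0 h1 hs)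
  have hc : 0 < c := by linarith
  have hsum : ∀ z, 0 < z → HasSum (fun k : ℕ => (1 - η) ^ k * h (1 / (z * (1 - η) ^ k)))
      (z⁻¹ * geomSum h (1 - η) z) := fun z hz => by
    refine ((hs z hz).hasSum.mul_left z⁻¹).congr_fun fun k => ?_
    rw [perspective]
    field_simp
  refine ⟨c, hardyConstant_eq hE hI he hh hw hc (fun n => ?_) (fun z hz hzc => ?_),
    ⟨hc, fun h => (hη.ne' h).elim, fun _ => ?_⟩, ?_⟩
  · refine ⟨1 - η, h0, h1, hs, fun j _ => ?_, hneg⟩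
    rw [sub_sub_cancel]
    exact hw.antitone.le_of_tendsto hlim j
  · exact ⟨1 - η, h0, h1, hs, hw.hasGeometricMass_of_tendsto_pos hη hη1 hlim, hpos z hz hzc⟩
  · have := hsum c hc
    rwa [hc0, mul_zero] at this
  · rintro c' ⟨hc', -, hsol⟩
    have h2 := (hsum c' hc').unique (hsol hη)
    have h3 := (mul_eq_zero.1 h2).resolve_left (inv_pos.2 hc').ne'
    rcases lt_trichotomy c' c with h4 | h4 | h4
    · exact absurd h3 (hpos c' hc' h4).ne'
    · exact h4
    · exact absurd h3 (hneg c' h4).ne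

end CriticalConstant

theorem mainTheorem1 (w : ℕ → ℝ) (hw0 : 0 < w 0) (hw : ∀ n, 0 ≤ w n)
    (hW : Tendsto (fun n => ∑ i ∈ Finset.range (n + 1), w i) atTop atTop)
    (hanti : Antitone (fun n => w n / ∑ i ∈ Finset.range (n + 1), w i))
    (η : ℝ) (hη : η ∈ Ico (0 : ℝ) 1)
    (hlim : Tendsto (fun n => w n / ∑ i ∈ Finset.range (n + 1), w i) atTop (𝓝 η))
    (I : Set ℝ) (hI : I.OrdConnected) (hInt : I.Nontrivial) (hI0 : IsGLB I 0)
    (E : ℝ → ℝ → ℝ) (hE : IsNormalizableQuasideviation I E)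
    (hconc : ConcaveOn ℝ (I ×ˢ I) (fun p : ℝ × ℝ => normalization I E p.1 p.2))
    (hzero : ∀ x : ℝ, 0 < x →
      Tendsto (fun t => normalization I E (x * t) t) (𝓝[>] 0) (𝓝 0)) :
    (∀ x : ℝ, 0 < x → Tendsto (fun t => t⁻¹ * normalization I E (x * t) t) (𝓝[>] 0)
      (𝓝 (homogenizedDeviation I E x))) ∧
    (IsHardyMean I (quasideviationMean I E) w ↔
      IntegrableOn (fun x => homogenizedDeviation I E (1 / x)) (Ioc 0 1)) ∧
    (IsHardyMean I (quasideviationMean I E) w →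
      ∃ c : ℝ, hardyConstant I (quasideviationMean I E) w = ENNReal.ofReal c ∧
        SolvesHardyEquation (homogenizedDeviation I E) η c ∧
        ∀ c' : ℝ, SolvesHardyEquation (homogenizedDeviation I E) η c' → c' = c) := by
  have hw' : IsHardyWeight w := isHardyWeight_of_nonneg hw0 hw hW hanti
  have hlim' : Tendsto (fun n => w n / cumSum w n) atTop (𝓝 η) := hlim
  have he := hE.isConcaveDeviation hI hInt hI0 hconc hzero
  have hh := he.hasHomogenization
  have hcrit : (∀ b, IntegrableOn (fun y => homogenizedDeviation I E (1 / y)) (Ioc 0 b)) →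
      ∃ c : ℝ, hardyConstant I (quasideviationMean I E) w = ENNReal.ofReal c ∧
        SolvesHardyEquation (homogenizedDeviation I E) η c ∧
        ∀ c' : ℝ, SolvesHardyEquation (homogenizedDeviation I E) η c' → c' = c := by
    intro hi
    rcases hη.1.eq_or_lt with rfl | h0
    · exact exists_hardyConstant_eq_of_zero hE hI he hh hw' hlim' hi
    · exact exists_hardyConstant_eq_of_pos hE hI he hh hw' h0 hη.2 hlim' hi
  refine ⟨hh, ⟨fun hH => integrableOn_of_isHardyMean hE hI he hh hw' hη hlim' hH 1, fun hi => ?_⟩,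
    fun hH => hcrit (integrableOn_of_isHardyMean hE hI he hh hw' hη hlim' hH)⟩
  obtain ⟨c, hc, -⟩ := hcrit
    ((he.isConcaveKernel hh).antitoneOn_inv.integrableOn_Ioc_zero one_pos hi)
  rw [IsHardyMean, hc]
  exact ENNReal.ofReal_lt_top
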